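/- For a function $B$ on $[0,\infty)$ let $\|B\|_{L^\infty}$ be its essential supremum norm with respect to Lebesgue measure, and let $BV_{\rm loc}[0,\infty)$ be the set of functions on $[0,\infty)$ having finite total variation on every compact subinterval of $[0,\infty)$. **Theorem 3.1 (Tauberian theorem for the Stieltjes transform).** There is a universal constant $C>0$ with the following property. Let $\delta,t_0>0$. Let $B_0,B_1,B_2:[0,\infty)\to\mathbb R$ be such that $B_0$ is bounded, $B_1$ is nondecreasing and right-continuous, and assume that $$C_{B_2}:=\sup_{t\ge0}\frac{|B_2(t)|}{t_0+t},\qquad -C_{B_0}:=\inf_{0\le u\le v\le u+\delta}\min\{u(B_0(v^2)-B_0(u^2)),0\}$$ are finite. Assume also that $u\mapsto u^3B_0(u^2)$ and $u\mapsto B_2(u^2)$ are right-continuous on $[0,\infty)$ and belong to $BV_{\rm loc}[0,\infty)$. Assume that there are $C_0,\Lambda,\epsilon_0>0$ such that for all $\lambda\ge\Lambda$ the following integral converges absolutely and satisfies $$\left|\int_0^\infty\frac{B_0(t)t^{3/2}+B_1(t)+B_2(t)}{(t+\lambda)^3}\,dt\right|\le C_0\,\frac{e^{-\epsilon_0\sqrt{\lambda}}}{\lambda}.$$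 Then $B_0(t)\,t^{3/2}+B_1(t)+B_2(t)=\mathcal O(t)$ as $t\to+\infty$. More precisely, for all $t\ge0$, $$|B_0(t)\,t^{3/2}+B_1(t)+B_2(t)|\le\mathcal B\,\epsilon_0^{-1}\left(t+\epsilon_0^{-2}\right)$$ with some number $\mathcal B$ satisfying $$\begin{aligned} \mathcal B\le{}& C\epsilon_0^3\left(1+\epsilon_0\sqrt\Lambda\,e^{\epsilon_0\sqrt\Lambda/2}\right)\left(\|B_0\|_{L^\infty}\Lambda^{3/2}+|B_1(0)|+C_{B_2}t_0(1+\delta^{-1}\epsilon_0^{-1})+C_{B_2}\Lambda\right)\\ &+C\epsilon_0^3\Lambda\left(\epsilon_0\sqrt\Lambda\,e^{\epsilon_0\sqrt\Lambda/2}+\epsilon_0^{-2}\Lambda^{-1}\right)C_0\\ &+C\left(\epsilon_0+\delta^{-1}\right)\left(C_{B_0}+\|B_0\|_{L^\infty}\left(\delta+\epsilon_0^{-1}\right)+C_{B_2}\left(1+\ln(1+\delta\epsilon_0)\right)\right). \end{aligned}$$ -/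

import Mathlib

open MeasureTheory Set Filter Asymptotics
open scoped ENNReal

noncomputable section

namespace StieltjesTauber

/-- The function `A(t) = B₀(t) t^{3/2} + B₁(t) + B₂(t)`; only its values for `t ≥ 0` matter. -/
def total (B₀ B₁ B₂ : ℝ → ℝ) (t : ℝ) : ℝ :=
  B₀ t * t ^ (3 / 2 : ℝ) + B₁ t + B₂ t

/-- The norm of `B` in `L^∞([0,∞))` (essential supremum with respect to Lebesgue measure). -/
def linftyNorm (B : ℝ → ℝ) : ℝ :=
  (eLpNorm B ∞ (volume.restrict (Ici 0))).toReal

/-- The values `|B(t)| / (t₀ + t)`, `t ≥ 0`. -/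
def growthRatios (t₀ : ℝ) (B : ℝ → ℝ) : Set ℝ :=
  {x | ∃ t : ℝ, 0 ≤ t ∧ x = |B t| / (t₀ + t)}

/-- The values `min {u (B(v²) - B(u²)), 0}`, `0 ≤ u ≤ v ≤ u + δ`. -/
def monotonicityDefects (δ : ℝ) (B : ℝ → ℝ) : Set ℝ :=
  {x | ∃ u v : ℝ, 0 ≤ u ∧ u ≤ v ∧ v ≤ u + δ ∧ x = min (u * (B (v ^ 2) - B (u ^ 2))) 0}

/-- Right-continuity of a function on `[0,∞)`. -/
def RightContinuous (f : ℝ → ℝ) : Prop :=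
  ∀ t : ℝ, 0 ≤ t → ContinuousWithinAt f (Ioi t) t

end StieltjesTauber

end

namespace StieltjesTauber

/-! Put `N(u) = sign(u) A(u²/ε₀²)`, where `A` is the total function. The substitution `t = (u/ε₀)²`,
`λ = (z/ε₀)²` turns the hypothesis into `∫₀^∞ N(u) u/(u²+z²)³ du = O(e^{-z})`. Up to the harmless
factor `8/z³`, this integral is the Laplace transform of `g(x) = ∫ N(u) ker u x du`, and a Laplace
transform that is `O(e^{-z})` on the positive reals forces `g = 0` on `(0, 1)`
(`eq_zero_of_laplace_le`).

The sine transform of an odd test function supported in `(-1, 1)` is a superposition of the `ker u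
x` with `0 < x < 1`, so `N` annihilates it: the odd function `N` has no spectrum in `(-1, 1)`. Hence
`N` is annihilated by every translate of an even kernel `φ ≥ 0` with fast decay, `φ(0) > 0` and
Fourier transform supported in `[-1/2, 1/2]` (`integral_mul_testKernel_eq_zero`).

The rest is a one-sided Tauberian argument (`exists_abs_le_of_annihilated`). If `N` drops by at most
`K(1+u²)` over unit steps, then averaging the increments of `N` against `φ` bounds them from above
as well. Comparing `N(x)` with its vanishing `φ`-average then gives `|N(x)| ≤ C K(1+x²)`. The lower
bound on increments comes from the near-monotonicity of `B₀`, the monotonicity of `B₁` and the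
linear growth of `B₂`.

The decay hypothesis serves only to produce an exact vanishing, so neither its constant nor its
threshold enters `K`. -/

/-! ### Exponentially small Laplace transforms on the real axis. -/

lemma abs_one_sub_exp_neg_exp_le {n m w : ℝ} (hm : 0 ≤ m) (hmn : m ≤ n) :
    |1 - Real.exp (-Real.exp (n * w))| ≤ Real.exp (m * w) := by
  have h1 : 0 ≤ 1 - Real.exp (-Real.exp (n * w)) := by
    have : Real.exp (-Real.exp (n * w)) ≤ 1 := Real.exp_le_one_iff.2 (by
      have := Real.exp_pos (n * w); linarith)
    linarith
  rw [abs_of_nonneg h1]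
  rcases le_total 0 w with hw | hw
  · have : (1 : ℝ) ≤ Real.exp (m * w) := Real.one_le_exp (by positivity)
    have := Real.exp_pos (-Real.exp (n * w))
    linarith
  · have h2 := Real.add_one_le_exp (-Real.exp (n * w))
    have h3 : Real.exp (n * w) ≤ Real.exp (m * w) :=
      Real.exp_le_exp.2 (mul_le_mul_of_nonpos_right hmn hw)
    linarith

lemma hasSum_one_sub_exp_neg (E : ℝ) :
    HasSum (fun k : ℕ => (-1) ^ k / ((k + 1).factorial : ℝ) * E ^ (k + 1)) (1 - Real.exp (-E)) := by
  have h := NormedSpace.expSeries_div_hasSum_exp (-E)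
  rw [← Real.exp_eq_exp_ℝ] at h
  have h2 := ((hasSum_nat_add_iff' 1).2 h).neg
  simp only [Finset.range_one, Finset.sum_singleton, pow_zero, Nat.factorial_zero, Nat.cast_one,
    div_one, neg_sub] at h2
  have h3 : (fun k : ℕ => (-1) ^ k / ((k + 1).factorial : ℝ) * E ^ (k + 1)) =
      fun k : ℕ => -((-E) ^ (k + 1) / ((k + 1).factorial : ℝ)) := by
    funext k
    rw [neg_pow E, pow_succ (-1 : ℝ) k]
    ring
  rw [h3]
  exact h2

/-- If the Laplace transform of `g` is `O(e^{-z})` along the positive reals, then the primitive of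
`g` vanishes on `(0, 1)`. -/
theorem integral_eq_zero_of_laplace_le {g : ℝ → ℝ} {a C Z y : ℝ}
    (hint : IntegrableOn (fun x => Real.exp (-(a * x)) * g x) (Ioi 0))
    (hG : ∀ z, Z ≤ z → |∫ x in Ioi (0 : ℝ), Real.exp (-(z * x)) * g x| ≤ C * Real.exp (-z))
    (hy : y < 1) : ∫ x in Ioi (0 : ℝ), (Iic y).indicator g x = 0 := by
  obtain ⟨n₀, hn₀⟩ := exists_nat_ge (max (max a Z) 1)
  have ha : a ≤ n₀ := le_trans (le_trans (le_max_left _ _) (le_max_left _ _)) hn₀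
  have hZ : Z ≤ n₀ := le_trans (le_trans (le_max_right _ _) (le_max_left _ _)) hn₀
  have h1 : (1 : ℝ) ≤ n₀ := le_trans (le_max_right _ _) hn₀
  have hgm : AEStronglyMeasurable g (volume.restrict (Ioi 0)) := by
    have h2 : AEStronglyMeasurable (fun x => Real.exp (a * x) * (Real.exp (-(a * x)) * g x))
        (volume.restrict (Ioi 0)) :=
      (Continuous.aestronglyMeasurable (by fun_prop)).mul hint.aestronglyMeasurable
    refine h2.congr (Eventually.of_forall fun x => ?_)
    simp only
    rw [← mul_assoc, ← Real.exp_add]; simp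
  have hle : ∀ z, (n₀ : ℝ) ≤ z → ∀ x ∈ Ioi (0 : ℝ), ‖Real.exp (-(z * x)) * g x‖ ≤
      ‖Real.exp (-(n₀ * x)) * g x‖ := by
    intro z hz x hx
    rw [norm_mul, norm_mul]
    refine mul_le_mul_of_nonneg_right ?_ (norm_nonneg _)
    rw [Real.norm_eq_abs, Real.norm_eq_abs, Real.abs_exp, Real.abs_exp]
    exact Real.exp_le_exp.2 (neg_le_neg (mul_le_mul_of_nonneg_right hz (le_of_lt hx)))
  have hi₀ : IntegrableOn (fun x => Real.exp (-(n₀ * x)) * g x) (Ioi 0) := by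
    refine Integrable.mono hint
      ((Continuous.aestronglyMeasurable (by fun_prop)).mul hgm) ?_
    refine (ae_restrict_iff' measurableSet_Ioi).2 (Eventually.of_forall fun x hx => ?_)
    rw [norm_mul, norm_mul]
    refine mul_le_mul_of_nonneg_right ?_ (norm_nonneg _)
    rw [Real.norm_eq_abs, Real.norm_eq_abs, Real.abs_exp, Real.abs_exp]
    exact Real.exp_le_exp.2 (neg_le_neg (mul_le_mul_of_nonneg_right ha (le_of_lt hx)))
  have hi : ∀ z, (n₀ : ℝ) ≤ z → IntegrableOn (fun x => Real.exp (-(z * x)) * g x) (Ioi 0) := by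
    intro z hz
    refine Integrable.mono hi₀ ((Continuous.aestronglyMeasurable (by fun_prop)).mul hgm) ?_
    exact (ae_restrict_iff' measurableSet_Ioi).2 (Eventually.of_forall (hle z hz))
  have hC : 0 ≤ C := by
    have h2 := (abs_nonneg _).trans (hG Z le_rfl)
    exact nonneg_of_mul_nonneg_left h2 (Real.exp_pos _)
  -- The weight `1 - exp(-e^{n(y-x)})` tends to the indicator of `x < y`. Its expansion in powers of
  -- `e^{n(y-x)}` makes `J n` a series in the values of the Laplace transform at `n, 2n, 3n, …`, so
  -- real `z` suffice.
  set J : ℕ → ℝ := fun n => ∫ x in Ioi (0 : ℝ), (1 - Real.exp (-Real.exp (n * (y - x)))) * g x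
  -- The `k`-th term is at most `C e^{(k+1)ny} e^{-(k+1)n}/(k+1)!`. These sum to an exponential
  -- series which tends to `0` because `y < 1`.
  have hJ : ∀ n : ℕ, n₀ ≤ n → |J n| ≤ C * (Real.exp (Real.exp (-(n * (1 - y)))) - 1) := by
    intro n hn
    have hn' : (n₀ : ℝ) ≤ n := by exact_mod_cast hn
    set F : ℕ → ℝ → ℝ := fun k x =>
      (-1) ^ k / ((k + 1).factorial : ℝ) * Real.exp (n * y) ^ (k + 1) *
        (Real.exp (-(((k + 1 : ℕ) * n) * x)) * g x) with hF
    have hkn : ∀ k : ℕ, (n₀ : ℝ) ≤ (k + 1 : ℕ) * n := by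
      intro k
      push_cast
      nlinarith [(Nat.cast_nonneg k : (0 : ℝ) ≤ k), (Nat.cast_nonneg n : (0 : ℝ) ≤ n)]
    have hFi : ∀ k, Integrable (F k) (volume.restrict (Ioi 0)) := fun k =>
      (hi _ (hkn k)).const_mul _
    have hFs : Summable fun k => ∫ x in Ioi (0 : ℝ), ‖F k x‖ := by
      set M := ∫ x in Ioi (0 : ℝ), ‖Real.exp (-(n₀ * x)) * g x‖
      have hs : Summable fun k : ℕ => Real.exp (n * y) ^ (k + 1) / ((k + 1).factorial : ℝ) * M :=
        ((summable_nat_add_iff 1).2 (Real.summable_pow_div_factorial _)).mul_right _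
      refine Summable.of_nonneg_of_le (fun k => integral_nonneg fun x => norm_nonneg _)
        (fun k => ?_) hs
      simp only [hF, norm_mul _ (Real.exp _ * g _)]
      rw [integral_const_mul]
      have h3 : ‖(-1 : ℝ) ^ k / ((k + 1).factorial : ℝ) * Real.exp (n * y) ^ (k + 1)‖ =
          Real.exp (n * y) ^ (k + 1) / ((k + 1).factorial : ℝ) := by
        rw [norm_mul, norm_div, norm_pow, norm_neg, norm_one, one_pow,
          Real.norm_of_nonneg (by positivity), Real.norm_of_nonneg (by positivity)]
        ring
      rw [norm_mul] at h3
      rw [norm_mul, h3]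
      refine mul_le_mul_of_nonneg_left ?_ (by positivity)
      exact setIntegral_mono_on (hi _ (hkn k)).norm hi₀.norm measurableSet_Ioi
        (hle _ (hkn k))
    have hsum := hasSum_integral_of_summable_integral_norm hFi hFs
    have hts : ∫ x in Ioi (0 : ℝ), ∑' k, F k x = J n := by
      refine integral_congr_ae (Eventually.of_forall fun x => ?_)
      simp only
      have h4 := (hasSum_one_sub_exp_neg (Real.exp (n * (y - x)))).mul_right (g x)
      rw [← h4.tsum_eq]
      refine tsum_congr fun k => ?_
      simp only [hF]
      rw [← mul_assoc, mul_assoc _ (Real.exp (n * y) ^ (k + 1)), ← Real.exp_nat_mul,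
        ← Real.exp_add, ← Real.exp_nat_mul]
      congr 3
      push_cast; ring_nf
    rw [hts] at hsum
    have hs2 : HasSum (fun k : ℕ => C * (Real.exp (-(n * (1 - y))) ^ (k + 1) /
        ((k + 1).factorial : ℝ))) (C * (Real.exp (Real.exp (-(n * (1 - y)))) - 1)) := by
      have h := NormedSpace.expSeries_div_hasSum_exp (Real.exp (-(n * (1 - y))))
      rw [← Real.exp_eq_exp_ℝ] at h
      have h2 := ((hasSum_nat_add_iff' 1).2 h)
      simp only [Finset.range_one, Finset.sum_singleton, pow_zero, Nat.factorial_zero,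
        Nat.cast_one, div_one] at h2
      exact h2.mul_left C
    rw [← hsum.tsum_eq, ← hs2.tsum_eq, ← Real.norm_eq_abs]
    refine tsum_of_norm_bounded hs2.summable.hasSum fun k => ?_
    simp only [hF]
    rw [integral_const_mul, norm_mul, norm_mul, norm_div, norm_pow, norm_neg, norm_one, one_pow,
      Real.norm_of_nonneg (by positivity), Real.norm_of_nonneg (by positivity),
      Real.norm_eq_abs]
    calc _ ≤ 1 / ((k + 1).factorial : ℝ) * Real.exp (n * y) ^ (k + 1) *
          (C * Real.exp (-((k + 1 : ℕ) * n))) := by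
          refine mul_le_mul_of_nonneg_left (hG _ (hZ.trans (hkn k))) (by positivity)
      _ = _ := by
          rw [← Real.exp_nat_mul, ← Real.exp_nat_mul,
            show ((k + 1 : ℕ) : ℝ) * -(n * (1 - y)) = (k + 1 : ℕ) * (n * y) +
              -((k + 1 : ℕ) * n) by ring, Real.exp_add]
          ring
  have hlim0 : Tendsto J atTop (nhds 0) := by
    have h5 : Tendsto (fun n : ℕ => C * (Real.exp (Real.exp (-(n * (1 - y)))) - 1)) atTop
        (nhds (C * (Real.exp 0 - 1))) := by
      have h6 : Tendsto (fun n : ℕ => Real.exp (-((n : ℝ) * (1 - y)))) atTop (nhds 0) :=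
        Real.tendsto_exp_neg_atTop_nhds_zero.comp
          (tendsto_natCast_atTop_atTop.atTop_mul_const (by linarith))
      exact (((Real.continuous_exp.tendsto 0).comp h6).sub_const 1).const_mul C
    simp only [Real.exp_zero, sub_self, mul_zero] at h5
    exact squeeze_zero_norm' ((eventually_ge_atTop n₀).mono hJ) h5
  -- `abs_one_sub_exp_neg_exp_le` dominates every weight with `n ≥ n₀` by `e^{n₀(y-x)}`.
  have hlim1 : Tendsto J atTop (nhds (∫ x in Ioi (0 : ℝ), (Iic y).indicator g x)) := by
    refine tendsto_integral_filter_of_dominated_convergence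
      (fun x => Real.exp (n₀ * y) * ‖Real.exp (-(n₀ * x)) * g x‖) ?_ ?_
      (hi₀.norm.const_mul _) ?_
    · exact Eventually.of_forall fun n =>
        (Continuous.aestronglyMeasurable (by fun_prop)).mul hgm
    · filter_upwards [eventually_ge_atTop n₀] with n hn
      refine Eventually.of_forall fun x => ?_
      have hn' : (n₀ : ℝ) ≤ n := by exact_mod_cast hn
      rw [norm_mul, norm_mul, ← mul_assoc]
      refine mul_le_mul_of_nonneg_right ?_ (norm_nonneg _)
      rw [Real.norm_eq_abs, Real.norm_eq_abs, Real.abs_exp, ← Real.exp_add]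
      refine (abs_one_sub_exp_neg_exp_le (by linarith) hn').trans (le_of_eq ?_)
      congr 1; ring
    · have h7 : ∀ᵐ x ∂(volume.restrict (Ioi (0 : ℝ))), x ≠ y :=
        ae_restrict_of_ae (by simp [ae_iff, measure_singleton])
      filter_upwards [h7] with x hx
      have h8 : ∀ c : ℝ, Tendsto (fun n : ℕ => 1 - Real.exp (-Real.exp (n * (y - x)))) atTop
          (nhds c) → Tendsto (fun n : ℕ => (1 - Real.exp (-Real.exp (n * (y - x)))) * g x) atTop
          (nhds (c * g x)) := fun c h => h.mul_const _
      rcases lt_or_gt_of_ne hx with hlt | hgt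
      · rw [indicator_of_mem (show x ∈ Iic y from hlt.le)]
        have h9 : Tendsto (fun n : ℕ => Real.exp (-Real.exp (n * (y - x)))) atTop (nhds 0) :=
          Real.tendsto_exp_neg_atTop_nhds_zero.comp (Real.tendsto_exp_atTop.comp
            (tendsto_natCast_atTop_atTop.atTop_mul_const (by linarith)))
        simpa using h8 1 (by simpa using h9.const_sub 1)
      · rw [indicator_of_notMem (show x ∉ Iic y from not_le.2 hgt)]
        have h9 : Tendsto (fun n : ℕ => Real.exp ((n : ℝ) * (y - x))) atTop (nhds 0) :=
          Real.tendsto_exp_atBot.comp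
            (tendsto_natCast_atTop_atTop.atTop_mul_const_of_neg (by linarith))
        have h10 : Tendsto (fun n : ℕ => Real.exp (-Real.exp (n * (y - x)))) atTop (nhds 1) := by
          have := (Real.continuous_exp.tendsto (-0)).comp h9.neg
          simpa [Function.comp_def] using this
        simpa using h8 0 (by simpa using h10.const_sub 1)
  exact tendsto_nhds_unique hlim1 hlim0

/-- A continuous function whose Laplace transform is `O(e^{-z})` vanishes on `[0, 1]`. -/
theorem eq_zero_of_laplace_le {g : ℝ → ℝ} {a C Z : ℝ} (hg : Continuous g)
    (hint : IntegrableOn (fun x => Real.exp (-(a * x)) * g x) (Ioi 0))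
    (hG : ∀ z, Z ≤ z → |∫ x in Ioi (0 : ℝ), Real.exp (-(z * x)) * g x| ≤ C * Real.exp (-z)) :
    ∀ y ∈ Ioo (0 : ℝ) 1, g y = 0 := by
  have h0 : ∀ y ∈ Ioo (0 : ℝ) 1, ∫ x in (0 : ℝ)..y, g x = 0 := by
    intro y hy
    have h := integral_eq_zero_of_laplace_le hint hG hy.2
    rw [setIntegral_indicator measurableSet_Iic, Ioi_inter_Iic] at h
    rw [intervalIntegral.integral_of_le hy.1.le, h]
  intro y hy
  have hd := (intervalIntegral.integral_hasDerivAt_right (hg.intervalIntegrable 0 y)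
    (hg.stronglyMeasurableAtFilter _ _) hg.continuousAt)
  have hd0 : HasDerivAt (fun y => ∫ x in (0 : ℝ)..y, g x) 0 y := by
    refine (hasDerivAt_const y (0 : ℝ)).congr_of_eventuallyEq ?_
    filter_upwards [isOpen_Ioo.mem_nhds hy] with t ht using h0 t ht
  exact hd.unique hd0

/-! ### The kernel, its derivatives and its size. -/

/-- The inverse Laplace transform of `z ↦ 8u / (z³ (z² + u²)³)`. -/
noncomputable def ker (u x : ℝ) : ℝ :=
  ((24 - (u * x) ^ 2) * Real.cos (u * x) + 9 * (u * x) * Real.sin (u * x) + 4 * (u * x) ^ 2 - 24)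
    / u ^ 7

/-- The first derivative of `ker u`. -/
noncomputable def ker₁ (u x : ℝ) : ℝ :=
  (8 * (u * x) - (15 - (u * x) ^ 2) * Real.sin (u * x) + 7 * (u * x) * Real.cos (u * x)) / u ^ 6

/-- The second derivative of `ker u`. -/
noncomputable def ker₂ (u x : ℝ) : ℝ :=
  (8 - (8 - (u * x) ^ 2) * Real.cos (u * x) - 5 * (u * x) * Real.sin (u * x)) / u ^ 5

/-- The third derivative of `ker u`. -/
noncomputable def ker₃ (u x : ℝ) : ℝ :=
  ((3 - (u * x) ^ 2) * Real.sin (u * x) - 3 * (u * x) * Real.cos (u * x)) / u ^ 4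

/-- `∫₀ˣ y sin(uy) dy`; the fourth derivative of `ker u` is `x ↦ x * sinMoment u x`. -/
noncomputable def sinMoment (u x : ℝ) : ℝ :=
  (Real.sin (u * x) - u * x * Real.cos (u * x)) / u ^ 2

lemma hasDerivAt_sin_mul (u x : ℝ) :
    HasDerivAt (fun x => Real.sin (u * x)) (Real.cos (u * x) * u) x := by
  simpa using ((hasDerivAt_id x).const_mul u).sin

lemma hasDerivAt_cos_mul (u x : ℝ) :
    HasDerivAt (fun x => Real.cos (u * x)) (-Real.sin (u * x) * u) x := by
  simpa using ((hasDerivAt_id x).const_mul u).cos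

lemma hasDerivAt_mul_left (u x : ℝ) : HasDerivAt (fun x => u * x) u x := by
  simpa using (hasDerivAt_id x).const_mul u

lemma hasDerivAt_ker {u : ℝ} (hu : u ≠ 0) (x : ℝ) : HasDerivAt (ker u) (ker₁ u x) x := by
  have hs := hasDerivAt_sin_mul u x
  have hc := hasDerivAt_cos_mul u x
  have hm := hasDerivAt_mul_left u x
  have h := (((((hm.pow 2).const_sub 24).mul hc).add ((hm.const_mul 9).mul hs)).add
    ((hm.pow 2).const_mul 4)).sub_const 24 |>.div_const (u ^ 7)
  refine h.congr_deriv ?_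
  simp only [ker₁, Pi.pow_apply]
  field_simp
  push_cast
  ring

lemma hasDerivAt_ker₁ {u : ℝ} (hu : u ≠ 0) (x : ℝ) : HasDerivAt (ker₁ u) (ker₂ u x) x := by
  have hs := hasDerivAt_sin_mul u x
  have hc := hasDerivAt_cos_mul u x
  have hm := hasDerivAt_mul_left u x
  have h := (((hm.const_mul 8).sub (((hm.pow 2).const_sub 15).mul hs)).add
    ((hm.const_mul 7).mul hc)) |>.div_const (u ^ 6)
  refine h.congr_deriv ?_
  simp only [ker₂, Pi.pow_apply]
  field_simp
  push_cast
  ring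

lemma hasDerivAt_ker₂ {u : ℝ} (hu : u ≠ 0) (x : ℝ) : HasDerivAt (ker₂ u) (ker₃ u x) x := by
  have hs := hasDerivAt_sin_mul u x
  have hc := hasDerivAt_cos_mul u x
  have hm := hasDerivAt_mul_left u x
  have h := ((((hm.pow 2).const_sub 8).mul hc).const_sub 8).sub
    ((hm.const_mul 5).mul hs) |>.div_const (u ^ 5)
  refine h.congr_deriv ?_
  simp only [ker₃, Pi.pow_apply]
  field_simp
  push_cast
  ring

lemma hasDerivAt_ker₃ {u : ℝ} (hu : u ≠ 0) (x : ℝ) :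
    HasDerivAt (ker₃ u) (x * sinMoment u x) x := by
  have hs := hasDerivAt_sin_mul u x
  have hc := hasDerivAt_cos_mul u x
  have hm := hasDerivAt_mul_left u x
  have h := (((hm.pow 2).const_sub 3).mul hs).sub
    ((hm.const_mul 3).mul hc) |>.div_const (u ^ 4)
  refine h.congr_deriv ?_
  simp only [sinMoment, Pi.pow_apply]
  field_simp
  push_cast
  ring

lemma hasDerivAt_sinMoment {u : ℝ} (hu : u ≠ 0) (x : ℝ) :
    HasDerivAt (sinMoment u) (x * Real.sin (u * x)) x := by
  have hs := hasDerivAt_sin_mul u x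
  have hc := hasDerivAt_cos_mul u x
  have hm := hasDerivAt_mul_left u x
  have h := (hs.sub (hm.mul hc)).div_const (u ^ 2)
  refine h.congr_deriv ?_
  field_simp
  ring

@[simp] lemma ker_zero (u : ℝ) : ker u 0 = 0 := by simp [ker]
@[simp] lemma ker₁_zero (u : ℝ) : ker₁ u 0 = 0 := by simp [ker₁]
@[simp] lemma ker₂_zero (u : ℝ) : ker₂ u 0 = 0 := by simp [ker₂]
@[simp] lemma ker₃_zero (u : ℝ) : ker₃ u 0 = 0 := by simp [ker₃]
@[simp] lemma sinMoment_zero (u : ℝ) : sinMoment u 0 = 0 := by simp [sinMoment]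

/-- Mean value inequality on `[0, x]`. Each integration gains a power of `x`, so the chain from
`sinMoment` to `ker` gives bounds uniform in `u`, in particular near `u = 0` where the explicit
formulas are singular. -/
lemma abs_le_pow_succ_of_hasDerivAt {f f' : ℝ → ℝ} {n : ℕ} (hf : ∀ x, HasDerivAt f (f' x) x)
    (h0 : f 0 = 0) (hb : ∀ x, 0 ≤ x → |f' x| ≤ x ^ n) {x : ℝ} (hx : 0 ≤ x) :
    |f x| ≤ x ^ (n + 1) := by
  have h := norm_image_sub_le_of_norm_deriv_le_segment' (f := f) (f' := f') (a := 0) (b := x)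
    (C := x ^ n) (fun y _ => (hf y).hasDerivWithinAt)
    (fun y hy => (hb y hy.1).trans (pow_le_pow_left₀ hy.1 hy.2.le n)) x ⟨hx, le_rfl⟩
  simpa [h0, pow_succ] using h

lemma abs_sinMoment_le {u x : ℝ} (hu : u ≠ 0) (hx : 0 ≤ x) : |sinMoment u x| ≤ x ^ 2 := by
  refine abs_le_pow_succ_of_hasDerivAt (hasDerivAt_sinMoment hu) (sinMoment_zero u)
    (fun y hy => ?_) hx
  rw [abs_mul, abs_of_nonneg hy, pow_one]
  exact mul_le_of_le_one_right hy (Real.abs_sin_le_one _)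

lemma abs_ker₃_le {u x : ℝ} (hu : u ≠ 0) (hx : 0 ≤ x) : |ker₃ u x| ≤ x ^ 4 := by
  refine abs_le_pow_succ_of_hasDerivAt (hasDerivAt_ker₃ hu) (ker₃_zero u) (fun y hy => ?_) hx
  rw [abs_mul, abs_of_nonneg hy, pow_succ' y 2]
  exact mul_le_mul_of_nonneg_left (abs_sinMoment_le hu hy) hy

lemma abs_ker₂_le {u x : ℝ} (hu : u ≠ 0) (hx : 0 ≤ x) : |ker₂ u x| ≤ x ^ 5 :=
  abs_le_pow_succ_of_hasDerivAt (hasDerivAt_ker₂ hu) (ker₂_zero u)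
    (fun _ hy => abs_ker₃_le hu hy) hx

lemma abs_ker₁_le {u x : ℝ} (hu : u ≠ 0) (hx : 0 ≤ x) : |ker₁ u x| ≤ x ^ 6 :=
  abs_le_pow_succ_of_hasDerivAt (hasDerivAt_ker₁ hu) (ker₁_zero u)
    (fun _ hy => abs_ker₂_le hu hy) hx

lemma abs_ker_le_pow {u x : ℝ} (hu : u ≠ 0) (hx : 0 ≤ x) : |ker u x| ≤ x ^ 7 :=
  abs_le_pow_succ_of_hasDerivAt (hasDerivAt_ker hu) (ker_zero u)
    (fun _ hy => abs_ker₁_le hu hy) hx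

lemma abs_ker_le_of_one_le {u x : ℝ} (hu : 1 ≤ u) (hx : 0 ≤ x) :
    |ker u x| ≤ 60 * (1 + x) ^ 2 / u ^ 5 := by
  have hu0 : 0 < u := by linarith
  have h1 := Real.abs_cos_le_one (u * x)
  have h2 := Real.abs_sin_le_one (u * x)
  have hX : 0 ≤ u * x := by positivity
  have hnum : |(24 - (u * x) ^ 2) * Real.cos (u * x) + 9 * (u * x) * Real.sin (u * x)
      + 4 * (u * x) ^ 2 - 24| ≤ 60 * (1 + u * x) ^ 2 := by
    have h3 : |(24 - (u * x) ^ 2) * Real.cos (u * x)| ≤ 24 + (u * x) ^ 2 := by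
      rw [abs_mul]
      refine (mul_le_of_le_one_right (abs_nonneg _) h1).trans ?_
      rw [abs_le]; constructor <;> nlinarith [sq_nonneg (u * x)]
    have h4 : |9 * (u * x) * Real.sin (u * x)| ≤ 9 * (u * x) := by
      rw [abs_mul, abs_of_nonneg (by positivity : 0 ≤ 9 * (u * x))]
      exact mul_le_of_le_one_right (by positivity) h2
    rw [abs_le] at h3 h4 ⊢
    constructor <;> nlinarith [sq_nonneg (u * x)]
  rw [ker, abs_div, abs_of_pos (pow_pos hu0 7), div_le_div_iff₀ (pow_pos hu0 7) (pow_pos hu0 5)]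
  have h5 : 1 + u * x ≤ u * (1 + x) := by nlinarith
  have h6 : (1 + u * x) ^ 2 ≤ (u * (1 + x)) ^ 2 := pow_le_pow_left₀ (by positivity) h5 2
  calc _ ≤ 60 * (u * (1 + x)) ^ 2 * u ^ 5 := by
        refine mul_le_mul_of_nonneg_right (hnum.trans ?_) (by positivity)
        linarith
    _ = _ := by ring

/-- For `u ≤ 1` the bound `x⁷` suffices; for `u ≥ 1` the explicit formula gives `u⁻⁵`, and `1920 =
60 · 2⁵` absorbs `(1+u)⁵ ≤ (2u)⁵`. The decay `u⁻⁵` is what makes the integral of `N` against `ker`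
converge absolutely. -/
lemma abs_ker_le {u x : ℝ} (hu : 0 < u) (hx : 0 ≤ x) :
    |ker u x| ≤ 1920 * (1 + x) ^ 7 / (1 + u) ^ 5 := by
  have hx1 : (1 : ℝ) ≤ 1 + x := by linarith
  rcases le_total u 1 with h | h
  · have h1 : x ^ 7 ≤ (1 + x) ^ 7 := pow_le_pow_left₀ hx (by linarith) 7
    have h2 : (1 + u) ^ 5 ≤ 2 ^ 5 := pow_le_pow_left₀ (by linarith) (by linarith) 5
    rw [le_div_iff₀ (by positivity)]
    calc _ ≤ (1 + x) ^ 7 * 2 ^ 5 :=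
          mul_le_mul ((abs_ker_le_pow hu.ne' hx).trans h1) h2 (by positivity) (by positivity)
      _ ≤ _ := by nlinarith [pow_pos (by linarith : 0 < 1 + x) 7]
  · have h1 : (1 + x) ^ 2 ≤ (1 + x) ^ 7 := pow_le_pow_right₀ hx1 (by norm_num)
    have h2 : (1 + u) ^ 5 ≤ (2 * u) ^ 5 := pow_le_pow_left₀ (by linarith) (by linarith) 5
    refine (abs_ker_le_of_one_le h hx).trans ?_
    rw [div_le_div_iff₀ (by positivity) (by positivity)]
    calc _ ≤ 60 * (1 + x) ^ 7 * (2 * u) ^ 5 :=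
          mul_le_mul (by linarith) h2 (by positivity) (by positivity)
      _ = _ := by ring

/-! ### The Laplace transform of the kernel -/

lemma tendsto_exp_neg_mul_mul_atTop {f : ℝ → ℝ} {C z : ℝ} {n : ℕ} (hz : 0 < z)
    (hb : ∀ x, 1 ≤ x → |f x| ≤ C * x ^ n) :
    Tendsto (fun x => Real.exp (-(z * x)) * f x) atTop (nhds 0) := by
  have h := (Real.tendsto_pow_mul_exp_neg_atTop_nhds_zero n).comp
    (tendsto_id.const_mul_atTop hz)
  have h2 : Tendsto (fun x => (C / z ^ n) * ((z * x) ^ n * Real.exp (-(z * x)))) atTop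
      (nhds 0) := by simpa using h.const_mul (C / z ^ n)
  refine squeeze_zero_norm' ?_ h2
  filter_upwards [eventually_ge_atTop 1] with x hx
  rw [norm_mul, Real.norm_eq_abs, Real.norm_eq_abs, Real.abs_exp, mul_comm]
  calc _ ≤ C * x ^ n * Real.exp (-(z * x)) :=
        mul_le_mul_of_nonneg_right (hb x hx) (Real.exp_pos _).le
    _ = _ := by rw [mul_pow]; field_simp

lemma integrableOn_pow_mul_exp_neg (n : ℕ) {z : ℝ} (hz : 0 < z) :
    IntegrableOn (fun x => Real.exp (-(z * x)) * x ^ n) (Ioi 0) := by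
  have h := integrableOn_rpow_mul_exp_neg_mul_rpow (p := 1) (s := n) (b := z)
    (by have := Nat.cast_nonneg (α := ℝ) n; linarith) one_pos hz
  refine h.congr_fun (fun x _ => ?_) measurableSet_Ioi
  simp only [Real.rpow_natCast, Real.rpow_one]
  rw [mul_comm, neg_mul]

lemma integrableOn_exp_neg_mul_of_le {f : ℝ → ℝ} {C z : ℝ} {n : ℕ} (hz : 0 < z)
    (hf : Continuous f) (hb : ∀ x, 0 ≤ x → |f x| ≤ C * x ^ n) :
    IntegrableOn (fun x => Real.exp (-(z * x)) * f x) (Ioi 0) := by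
  refine Integrable.mono' ((integrableOn_pow_mul_exp_neg n hz).const_mul C)
    (Continuous.aestronglyMeasurable (by fun_prop)) ?_
  refine (ae_restrict_iff' measurableSet_Ioi).2 (Eventually.of_forall fun x hx => ?_)
  rw [norm_mul, Real.norm_eq_abs, Real.norm_eq_abs, Real.abs_exp]
  calc _ ≤ Real.exp (-(z * x)) * (C * x ^ n) :=
        mul_le_mul_of_nonneg_left (hb x (le_of_lt hx)) (Real.exp_pos _).le
    _ = _ := by ring

/-- Integration by parts: the boundary terms vanish since `f 0 = 0` and `f` grows polynomially. Four
uses divide the transform of `x * sinMoment u x` by `z⁴`. -/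
lemma laplace_of_hasDerivAt {f f' : ℝ → ℝ} {z : ℝ} {n : ℕ} (hz : 0 < z)
    (hf : ∀ x, HasDerivAt f (f' x) x) (h0 : f 0 = 0) (hc : Continuous f')
    (hb : ∀ x, 0 ≤ x → |f' x| ≤ x ^ n) :
    ∫ x in Ioi (0 : ℝ), Real.exp (-(z * x)) * f x =
      (∫ x in Ioi (0 : ℝ), Real.exp (-(z * x)) * f' x) / z := by
  have hfc : Continuous f := continuous_iff_continuousAt.2 fun x => (hf x).continuousAt
  have hb1 : ∀ x, 0 ≤ x → |f x| ≤ 1 * x ^ (n + 1) := fun x hx => by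
    rw [one_mul]; exact abs_le_pow_succ_of_hasDerivAt hf h0 hb hx
  have hb' : ∀ x, 0 ≤ x → |f' x| ≤ 1 * x ^ n := fun x hx => by rw [one_mul]; exact hb x hx
  have i1 := integrableOn_exp_neg_mul_of_le hz hfc hb1
  have i2 := integrableOn_exp_neg_mul_of_le hz hc hb'
  have hd : ∀ x ∈ Ici (0 : ℝ), HasDerivAt (fun x => Real.exp (-(z * x)) * f x)
      (Real.exp (-(z * x)) * f' x - z * (Real.exp (-(z * x)) * f x)) x := by
    intro x _
    have h1 := (((hasDerivAt_mul_left z x).neg).exp).mul (hf x)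
    refine h1.congr_deriv ?_
    simp only [Pi.neg_apply]
    ring
  have h := integral_Ioi_of_hasDerivAt_of_tendsto' hd (i2.sub (i1.const_mul z))
    (tendsto_exp_neg_mul_mul_atTop hz fun x hx => hb1 x (by linarith))
  rw [integral_sub i2 (i1.const_mul z), integral_const_mul] at h
  simp only [h0, mul_zero, sub_zero] at h
  rw [eq_div_iff hz.ne']
  linarith

lemma laplace_mul_sinMoment {u z : ℝ} (hu : 0 < u) (hz : 0 < z) :
    ∫ x in Ioi (0 : ℝ), Real.exp (-(z * x)) * (x * sinMoment u x) =
      8 * z * u / (z ^ 2 + u ^ 2) ^ 3 := by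
  set D := z ^ 2 + u ^ 2 with hD
  have hD0 : 0 < D := by positivity
  -- Undetermined coefficients for an antiderivative `e^{-zx} W(x)`, with `W` quadratic in `x` times
  -- sine and cosine. The identities `e1`–`e6` match the coefficients of `sin` and `cos` times `1,
  -- x, x²`; the integral is then `-W(0) = -i₀`.
  set r₀ : ℝ := -((z ^ 2 - u ^ 2) / (u ^ 2 * D ^ 2)) - 2 * (3 * z ^ 2 * u - u ^ 3) / (u * D ^ 3)
    with hr₀
  set r₁ : ℝ := -(z / (u ^ 2 * D)) - 4 * z / D ^ 2 with hr₁
  set r₂ : ℝ := -(1 / D) with hr₂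
  set i₀ : ℝ := -(2 * z / (u * D ^ 2)) + 2 * (z ^ 3 - 3 * z * u ^ 2) / (u * D ^ 3) with hi₀
  set i₁ : ℝ := -(1 / (u * D)) + 2 * (z ^ 2 - u ^ 2) / (u * D ^ 2) with hi₁
  set i₂ : ℝ := z / (u * D) with hi₂
  set W : ℝ → ℝ := fun x => (r₀ + r₁ * x + r₂ * x ^ 2) * Real.sin (u * x) +
    (i₀ + i₁ * x + i₂ * x ^ 2) * Real.cos (u * x) with hW
  have e1 : r₁ - z * r₀ - u * i₀ = 0 := by
    rw [hr₁, hr₀, hi₀, hD]; field_simp; ring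
  have e2 : 2 * r₂ - z * r₁ - u * i₁ = 1 / u ^ 2 := by
    rw [hr₁, hr₂, hi₁, hD]; field_simp; ring
  have e3 : -(z * r₂) - u * i₂ = 0 := by
    rw [hr₂, hi₂, hD]; field_simp; ring
  have e4 : i₁ - z * i₀ + u * r₀ = 0 := by
    rw [hr₀, hi₀, hi₁, hD]; field_simp; ring
  have e5 : 2 * i₂ - z * i₁ + u * r₁ = 0 := by
    rw [hr₁, hi₁, hi₂, hD]; field_simp; ring
  have e6 : -(z * i₂) + u * r₂ = -(1 / u) := by
    rw [hr₂, hi₂, hD]; field_simp; ring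
  have hd : ∀ x ∈ Ici (0 : ℝ), HasDerivAt (fun x => Real.exp (-(z * x)) * W x)
      (Real.exp (-(z * x)) * (x * sinMoment u x)) x := by
    intro x _
    have hx2 : HasDerivAt (fun x : ℝ => x ^ 2) (2 * x) x := by simpa using hasDerivAt_pow 2 x
    have hR := ((hasDerivAt_mul_left r₁ x).const_add r₀).add (hx2.const_mul r₂)
    have hI := ((hasDerivAt_mul_left i₁ x).const_add i₀).add (hx2.const_mul i₂)
    have h1 := (((hasDerivAt_mul_left z x).neg).exp).mul
      ((hR.mul (hasDerivAt_sin_mul u x)).add (hI.mul (hasDerivAt_cos_mul u x)))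
    refine h1.congr_deriv ?_
    have e7 : x * sinMoment u x =
        (0 + 1 / u ^ 2 * x + 0 * x ^ 2) * Real.sin (u * x) +
        (0 + 0 * x + -(1 / u) * x ^ 2) * Real.cos (u * x) := by
      rw [sinMoment]; field_simp; ring
    rw [e7]
    simp only [Pi.neg_apply, Pi.add_apply, Pi.mul_apply]
    linear_combination Real.exp (-(z * x)) * (Real.sin (u * x) * (e1 + x * e2 + x ^ 2 * e3) +
      Real.cos (u * x) * (e4 + x * e5 + x ^ 2 * e6))
  have hb : ∀ x, 1 ≤ x → |W x| ≤ (|r₀| + |r₁| + |r₂| + (|i₀| + |i₁| + |i₂|)) * x ^ 2 := by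
    intro x hx
    have hq : ∀ a b c t : ℝ, |t| ≤ 1 → |(a + b * x + c * x ^ 2) * t| ≤
        (|a| + |b| + |c|) * x ^ 2 := by
      intro a b c t ht
      rw [abs_mul]
      refine (mul_le_of_le_one_right (abs_nonneg _) ht).trans ?_
      refine (abs_add_three _ _ _).trans ?_
      rw [abs_mul, abs_mul, abs_of_nonneg (by linarith : 0 ≤ x), abs_of_nonneg (sq_nonneg x)]
      have h1 : x ≤ x ^ 2 := by nlinarith
      have h2 : 1 ≤ x ^ 2 := by nlinarith
      nlinarith [mul_le_mul_of_nonneg_left h1 (abs_nonneg b),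
        mul_le_mul_of_nonneg_left h2 (abs_nonneg a)]
    rw [add_mul]
    exact (abs_add_le _ _).trans (add_le_add (hq _ _ _ _ (Real.abs_sin_le_one _))
      (hq _ _ _ _ (Real.abs_cos_le_one _)))
  have hc : Continuous fun x => x * sinMoment u x := by unfold sinMoment; fun_prop
  have hk : ∀ x, 0 ≤ x → |x * sinMoment u x| ≤ 1 * x ^ 3 := fun x hx => by
    rw [abs_mul, abs_of_nonneg hx, one_mul, pow_succ' x 2]
    exact mul_le_mul_of_nonneg_left (abs_sinMoment_le hu.ne' hx) hx
  have h := integral_Ioi_of_hasDerivAt_of_tendsto' hd (integrableOn_exp_neg_mul_of_le hz hc hk)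
    (tendsto_exp_neg_mul_mul_atTop hz hb)
  rw [h]
  simp only [hW, mul_zero, neg_zero, Real.exp_zero, Real.sin_zero, Real.cos_zero]
  rw [hi₀, hD]
  field_simp
  ring

lemma continuous_ker (u : ℝ) : Continuous (ker u) := by unfold ker; fun_prop

theorem laplace_ker {u z : ℝ} (hu : 0 < u) (hz : 0 < z) :
    ∫ x in Ioi (0 : ℝ), Real.exp (-(z * x)) * ker u x =
      8 * u / (z ^ 3 * (z ^ 2 + u ^ 2) ^ 3) := by
  rw [laplace_of_hasDerivAt hz (hasDerivAt_ker hu.ne') (ker_zero u)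
      (by unfold ker₁; fun_prop) (fun x hx => abs_ker₁_le hu.ne' hx),
    laplace_of_hasDerivAt hz (hasDerivAt_ker₁ hu.ne') (ker₁_zero u)
      (by unfold ker₂; fun_prop) (fun x hx => abs_ker₂_le hu.ne' hx),
    laplace_of_hasDerivAt hz (hasDerivAt_ker₂ hu.ne') (ker₂_zero u)
      (by unfold ker₃; fun_prop) (fun x hx => abs_ker₃_le hu.ne' hx),
    laplace_of_hasDerivAt (n := 3) hz (hasDerivAt_ker₃ hu.ne') (ker₃_zero u)
      (by unfold sinMoment; fun_prop) (fun x hx => by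
        rw [abs_mul, abs_of_nonneg hx, pow_succ' x 2]
        exact mul_le_mul_of_nonneg_left (abs_sinMoment_le hu.ne' hx) hx),
    laplace_mul_sinMoment hu hz]
  field_simp

/-! ### Hadamard's lemma and sine transforms of odd test functions. -/

open scoped ContDiff in
lemma hasDerivAt_integral_pow_mul_comp_mul {h : ℝ → ℝ} (hh : ContDiff ℝ 1 h) (n : ℕ) (x : ℝ) :
    HasDerivAt (fun x => ∫ s in (0 : ℝ)..1, s ^ n * h (s * x))
      (∫ s in (0 : ℝ)..1, s ^ (n + 1) * deriv h (s * x)) x := by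
  have hd : Continuous (deriv h) := hh.continuous_deriv le_rfl
  have hc : Continuous h := hh.continuous
  obtain ⟨B, hB⟩ := (isCompact_Icc (a := -(|x| + 1)) (b := |x| + 1)).exists_bound_of_continuousOn
    hd.continuousOn
  refine (intervalIntegral.hasDerivAt_integral_of_dominated_loc_of_deriv_le (μ := volume)
    (F := fun x s => s ^ n * h (s * x)) (F' := fun x s => s ^ (n + 1) * deriv h (s * x))
    (bound := fun _ => B) (Metric.ball_mem_nhds x one_pos) ?_ ?_ ?_ ?_ ?_ ?_).2
  · exact Eventually.of_forall fun y => Continuous.aestronglyMeasurable (by fun_prop)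
  · exact Continuous.intervalIntegrable (by fun_prop) _ _
  · exact Continuous.aestronglyMeasurable (by fun_prop)
  · refine Eventually.of_forall fun s hs y hy => ?_
    rw [uIoc_of_le zero_le_one] at hs
    have h1 : |y| ≤ |x| + 1 := by
      have h2 : |y - x| < 1 := hy
      have := abs_sub_abs_le_abs_sub y x
      linarith
    have h3 : |s * y| ≤ |x| + 1 := by
      rw [abs_mul, abs_of_pos hs.1]
      exact (mul_le_of_le_one_left (abs_nonneg y) hs.2).trans h1
    have h4 := hB (s * y) ⟨(abs_le.1 h3).1, (abs_le.1 h3).2⟩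
    rw [norm_mul, norm_pow, Real.norm_of_nonneg hs.1.le]
    exact (mul_le_of_le_one_left (norm_nonneg _) (pow_le_one₀ hs.1.le hs.2)).trans h4
  · exact intervalIntegrable_const
  · refine Eventually.of_forall fun s _ y _ => ?_
    have h5 := ((hh.differentiable one_ne_zero (s * y)).hasDerivAt.comp y
      (hasDerivAt_mul_left s y)).const_mul (s ^ n)
    refine h5.congr_deriv ?_
    ring

-- Differentiating in `x` raises the power of `s` and replaces `h` by `h'`, so the induction on `k`
-- must run over all `h` and `n` at once.
open scoped ContDiff in
lemma contDiff_integral_pow_mul_comp_mul (k : ℕ) : ∀ {h : ℝ → ℝ}, ContDiff ℝ ∞ h → ∀ n : ℕ,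
    ContDiff ℝ k (fun x => ∫ s in (0 : ℝ)..1, s ^ n * h (s * x)) := by
  induction k with
  | zero =>
    intro h hh n
    refine contDiff_zero.2 (continuous_iff_continuousAt.2 fun x => ?_)
    exact (hasDerivAt_integral_pow_mul_comp_mul (hh.of_le (by exact_mod_cast le_top)) n
      x).continuousAt
  | succ k ih =>
    intro h hh n
    have hD := hasDerivAt_integral_pow_mul_comp_mul (hh.of_le (by exact_mod_cast le_top)) n
    rw [Nat.cast_add, Nat.cast_one]
    refine contDiff_succ_iff_deriv.2 ⟨fun x => (hD x).differentiableAt, by simp, ?_⟩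
    rw [show deriv _ = _ from funext fun x => (hD x).deriv]
    exact ih (contDiff_infty_iff_deriv.1 hh).2 (n + 1)

open scoped ContDiff in
/-- Hadamard's lemma in one variable. -/
lemma exists_contDiff_eq_mul {q : ℝ → ℝ} (hq : ContDiff ℝ ∞ q) (h0 : q 0 = 0) :
    ∃ p : ℝ → ℝ, ContDiff ℝ ∞ p ∧ ∀ x, q x = x * p x := by
  obtain ⟨hdiff, hd⟩ := contDiff_infty_iff_deriv.1 hq
  refine ⟨fun x => ∫ s in (0 : ℝ)..1, s ^ 0 * deriv q (s * x),
    contDiff_infty.2 fun k => contDiff_integral_pow_mul_comp_mul k hd 0, fun x => ?_⟩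
  have h1 : ∀ s ∈ uIcc (0 : ℝ) 1, HasDerivAt (fun s => q (s * x)) (x * deriv q (s * x)) s := by
    intro s _
    have h2 : HasDerivAt (fun s => s * x) x s := by simpa using (hasDerivAt_id s).mul_const x
    exact ((hdiff (s * x)).hasDerivAt.comp s h2).congr_deriv (mul_comm _ _)
  have hdc : Continuous (deriv q) := hd.continuous
  have h3 := intervalIntegral.integral_eq_sub_of_hasDerivAt h1
    (Continuous.intervalIntegrable (by fun_prop) _ _)
  simp only [intervalIntegral.integral_const_mul, one_mul, zero_mul, h0, sub_zero] at h3
  simp only [pow_zero, one_mul]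
  exact h3.symm

open scoped ContDiff in
/-- Sine transforms of odd smooth functions supported in `(-1, 1)` are superpositions of the
functions `u ↦ ker u x`, `0 < x < 1`. -/
theorem exists_integral_ker_eq {q : ℝ → ℝ} {ρ : ℝ} (hq : ContDiff ℝ ∞ q)
    (hodd : ∀ x, q (-x) = -q x) (hρ0 : 0 < ρ) (hρ : ρ < 1) (hsupp : ∀ x, ρ ≤ x → q x = 0) :
    ∃ R : ℝ → ℝ, Continuous R ∧ ∀ u : ℝ, 0 < u →
      ∫ x in (0 : ℝ)..1, q x * Real.sin (u * x) = ∫ x in (0 : ℝ)..1, R x * ker u x := by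
  obtain ⟨p, hp, hqp⟩ := exists_contDiff_eq_mul hq (by have := hodd 0; simp at this; linarith)
  obtain ⟨hpd, hp'⟩ := contDiff_infty_iff_deriv.1 hp
  have hpeven : ∀ x, p (-x) = p x := by
    intro x
    rcases eq_or_ne x 0 with rfl | hx
    · simp
    · have h := hodd x
      rw [hqp, hqp x] at h
      have h1 : x * (p (-x) - p x) = 0 := by linarith
      rcases mul_eq_zero.1 h1 with h2 | h2
      · exact absurd h2 hx
      · linarith
  -- As `q` is odd, `p = q/x` is even and `p'` vanishes at `0`. This permits a second division, `p'
  -- = x r`, matching the fourth derivative `x * sinMoment u x` of `ker u`.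
  have hp0 : deriv p 0 = 0 := by
    have h : deriv (fun x => p (-x)) 0 = -deriv p (-0) := deriv_comp_neg p 0
    rw [show (fun x => p (-x)) = p from funext hpeven, neg_zero] at h
    linarith
  obtain ⟨r, hr, hpr⟩ := exists_contDiff_eq_mul hp' hp0
  have hps : ∀ x, ρ < x → p x = 0 := fun x hx => by
    have h := hsupp x hx.le
    rw [hqp] at h
    rcases mul_eq_zero.1 h with h | h
    · linarith
    · exact h
  have hlocal : ∀ f : ℝ → ℝ, (∀ x, ρ < x → f x = 0) → ∀ x, ρ < x → deriv f x = 0 := by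
    intro f hf x hx
    have h : f =ᶠ[nhds x] fun _ => 0 := by
      filter_upwards [isOpen_Ioi.mem_nhds hx] with t ht using hf t ht
    rw [h.deriv_eq, deriv_const]
  have hrs : ∀ x, ρ < x → r x = 0 := fun x hx => by
    have h := hlocal p hps x hx
    rw [hpr] at h
    rcases mul_eq_zero.1 h with h | h
    · linarith
    · exact h
  obtain ⟨hrd, hr1⟩ := contDiff_infty_iff_deriv.1 hr
  obtain ⟨hrd1, hr2⟩ := contDiff_infty_iff_deriv.1 hr1
  obtain ⟨hrd2, hr3⟩ := contDiff_infty_iff_deriv.1 hr2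
  obtain ⟨hrd3, hr4⟩ := contDiff_infty_iff_deriv.1 hr3
  have hs1 := hlocal _ hrs
  have hs2 := hlocal _ hs1
  have hs3 := hlocal _ hs2
  refine ⟨fun x => -deriv (deriv (deriv (deriv r))) x, hr4.continuous.neg, fun u hu => ?_⟩
  have hu' := hu.ne'
  have hqc : Continuous q := hq.continuous
  have hRc : Continuous (deriv (deriv (deriv (deriv r)))) := hr4.continuous
  have hkc := continuous_ker u
  -- Five integrations by parts at once: `q sin = p · sinMoment'` and `p' sinMoment = r · ker₃'`,
  -- after which derivatives move onto `r`. Boundary terms vanish at `0` through the kernels and at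
  -- `1` through the support of `p` and `r`.
  have hd : ∀ x ∈ uIcc (0 : ℝ) 1, HasDerivAt (fun x => p x * sinMoment u x - r x * ker₃ u x
      + deriv r x * ker₂ u x - deriv (deriv r) x * ker₁ u x
      + deriv (deriv (deriv r)) x * ker u x)
      (q x * Real.sin (u * x) + deriv (deriv (deriv (deriv r))) x * ker u x) x := by
    intro x _
    have h := (((((hpd x).hasDerivAt.mul (hasDerivAt_sinMoment hu' x)).sub
      ((hrd x).hasDerivAt.mul (hasDerivAt_ker₃ hu' x))).add
      ((hrd1 x).hasDerivAt.mul (hasDerivAt_ker₂ hu' x))).sub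
      ((hrd2 x).hasDerivAt.mul (hasDerivAt_ker₁ hu' x))).add
      ((hrd3 x).hasDerivAt.mul (hasDerivAt_ker hu' x))
    refine h.congr_deriv ?_
    rw [hpr x, hqp x]
    ring
  have i1 : IntervalIntegrable (fun x => q x * Real.sin (u * x)) volume 0 1 :=
    Continuous.intervalIntegrable (by fun_prop) _ _
  have i2 : IntervalIntegrable (fun x => deriv (deriv (deriv (deriv r))) x * ker u x)
      volume 0 1 := Continuous.intervalIntegrable (by fun_prop) _ _
  have h := intervalIntegral.integral_eq_sub_of_hasDerivAt hd (i1.add i2)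
  rw [intervalIntegral.integral_add i1 i2] at h
  simp only [hps 1 hρ, hrs 1 hρ, hs1 1 hρ, hs2 1 hρ, hs3 1 hρ, ker_zero, ker₁_zero, ker₂_zero,
    ker₃_zero, sinMoment_zero, mul_zero, zero_mul, sub_zero, add_zero] at h
  simp only [neg_mul, intervalIntegral.integral_neg]
  linarith

/-! ### Absence of spectrum in `(-1, 1)`. -/

lemma ker_neg (u x : ℝ) : ker u (-x) = ker u x := by
  simp [ker, mul_neg, Real.cos_neg, Real.sin_neg]

lemma measurable_ker : Measurable (Function.uncurry ker) := by
  unfold ker Function.uncurry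
  fun_prop

lemma aestronglyMeasurable_of_div {N : ℝ → ℝ}
    (hN : IntegrableOn (fun u => N u / (1 + u) ^ 5) (Ioi 0)) :
    AEStronglyMeasurable N (volume.restrict (Ioi 0)) := by
  have h : AEStronglyMeasurable (fun u => (1 + u) ^ 5 * (N u / (1 + u) ^ 5))
      (volume.restrict (Ioi 0)) :=
    (Continuous.aestronglyMeasurable (by fun_prop)).mul hN.aestronglyMeasurable
  refine h.congr ((ae_restrict_iff' measurableSet_Ioi).2 (Eventually.of_forall fun u hu => ?_))
  have : (1 + u) ^ 5 ≠ 0 := by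
    have : 0 < u := hu
    positivity
  simp only
  rw [← mul_div_assoc, mul_div_cancel_left₀ _ this]

/-- Absolute convergence for Fubini: `abs_ker_le` splits the kernel bound into a factor in `u` and a
factor in `x`. The set `T` is `(0, ∞)` for the Laplace transform and `(0, 1]` for test functions. -/
lemma integrable_prod_ker {N w : ℝ → ℝ} {T : Set ℝ}
    (hN : IntegrableOn (fun u => N u / (1 + u) ^ 5) (Ioi 0)) (hT : MeasurableSet T)
    (hT0 : T ⊆ Ioi 0) (hw : Continuous w) (hwi : IntegrableOn (fun x => w x * (1 + x) ^ 7) T) :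
    Integrable (Function.uncurry fun u x => N u * (w x * ker u x))
      ((volume.restrict (Ioi 0)).prod (volume.restrict T)) := by
  have hb := (hN.mul_prod (g := fun x => 1920 * (w x * (1 + x) ^ 7)) (hwi.const_mul 1920)).norm
  refine Integrable.mono' hb ?_ ?_
  · refine ((aestronglyMeasurable_of_div hN).comp_fst).mul ?_
    exact ((hw.measurable.comp measurable_snd).mul measurable_ker).aestronglyMeasurable
  · rw [Measure.prod_restrict]
    refine (ae_restrict_iff' (measurableSet_Ioi.prod hT)).2 (Eventually.of_forall ?_)
    rintro ⟨u, x⟩ ⟨hu, hx⟩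
    have hu : 0 < u := hu
    have hx : 0 < x := hT0 hx
    have hk := abs_ker_le hu hx.le
    simp only [Function.uncurry, norm_mul, norm_div, Real.norm_eq_abs, abs_pow]
    rw [abs_of_pos (by linarith : 0 < 1 + u), abs_of_pos (by linarith : 0 < 1 + x),
      abs_of_pos (by norm_num : (0 : ℝ) < 1920)]
    calc |N u| * (|w x| * |ker u x|)
        ≤ |N u| * (|w x| * (1920 * (1 + x) ^ 7 / (1 + u) ^ 5)) := by gcongr
      _ = _ := by ring

lemma integrableOn_exp_neg_mul_one_add_pow {z : ℝ} (hz : 0 < z) :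
    IntegrableOn (fun x => Real.exp (-(z * x)) * (1 + x) ^ 7) (Ioi 0) := by
  have h := ((integrableOn_pow_mul_exp_neg 0 hz).add
    (integrableOn_pow_mul_exp_neg 7 hz)).const_mul (2 ^ 6)
  refine Integrable.mono' h (Continuous.aestronglyMeasurable (by fun_prop)) ?_
  refine (ae_restrict_iff' measurableSet_Ioi).2 (Eventually.of_forall fun x hx => ?_)
  have hx : 0 < x := hx
  rw [Real.norm_of_nonneg (by positivity)]
  have h1 := add_pow_le zero_le_one hx.le 7
  simp only [Pi.add_apply]
  calc _ ≤ Real.exp (-(z * x)) * (2 ^ (7 - 1) * (1 ^ 7 + x ^ 7)) := by gcongr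
    _ = _ := by norm_num; ring

/-- Dominated convergence with `abs_ker_le` near `x₀`. Negative `x` are covered because `ker u` is
even. -/
lemma continuous_integral_mul_ker {N : ℝ → ℝ}
    (hN : IntegrableOn (fun u => N u / (1 + u) ^ 5) (Ioi 0)) :
    Continuous fun x => ∫ u in Ioi (0 : ℝ), N u * ker u x := by
  refine continuous_iff_continuousAt.2 fun x₀ => ?_
  refine continuousAt_of_dominated (bound := fun u => ‖N u / (1 + u) ^ 5‖ *
    (1920 * (2 + |x₀|) ^ 7)) ?_ ?_ (hN.norm.mul_const _) ?_
  · refine Eventually.of_forall fun x => (aestronglyMeasurable_of_div hN).mul ?_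
    exact (measurable_ker.comp (measurable_id.prodMk measurable_const)).aestronglyMeasurable
  · filter_upwards [Metric.ball_mem_nhds x₀ one_pos] with x hx
    refine (ae_restrict_iff' measurableSet_Ioi).2 (Eventually.of_forall fun u hu => ?_)
    have hu : 0 < u := hu
    have h1 : |x| ≤ |x₀| + 1 := by
      have h2 : |x - x₀| < 1 := hx
      have := abs_sub_abs_le_abs_sub x x₀
      linarith
    have hk : |ker u x| ≤ 1920 * (1 + |x|) ^ 7 / (1 + u) ^ 5 := by
      have h3 : ker u x = ker u |x| := by
        rcases abs_choice x with h | h <;> rw [h]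
        rw [ker_neg]
      rw [h3]
      exact abs_ker_le hu (abs_nonneg x)
    rw [norm_mul, norm_div, Real.norm_eq_abs, Real.norm_eq_abs, Real.norm_eq_abs, abs_pow,
      abs_of_pos (by linarith : 0 < 1 + u)]
    calc |N u| * |ker u x| ≤ |N u| * (1920 * (2 + |x₀|) ^ 7 / (1 + u) ^ 5) := by
          refine mul_le_mul_of_nonneg_left (hk.trans ?_) (abs_nonneg _)
          gcongr ?_ / _
          gcongr ?_ * ?_ ^ 7
          linarith
      _ = _ := by ring
  · exact Eventually.of_forall fun u => ((continuous_ker u).const_mul (N u)).continuousAt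

/-- A function whose Stieltjes transform decays like `e^{-z}` has no spectrum in `(-1, 1)`:
weak form, for `ker`. -/
lemma integral_mul_ker_eq_zero {N : ℝ → ℝ} {C Z : ℝ}
    (hN : IntegrableOn (fun u => N u / (1 + u) ^ 5) (Ioi 0))
    (hF : ∀ z, Z ≤ z → |∫ u in Ioi (0 : ℝ), N u * (u / (u ^ 2 + z ^ 2) ^ 3)| ≤
      C * Real.exp (-z)) :
    ∀ x ∈ Ioo (0 : ℝ) 1, ∫ u in Ioi (0 : ℝ), N u * ker u x = 0 := by
  have hprod : ∀ z : ℝ, 0 < z → Integrable (Function.uncurry fun u x =>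
      N u * (Real.exp (-(z * x)) * ker u x))
      ((volume.restrict (Ioi 0)).prod (volume.restrict (Ioi 0))) := fun z hz =>
    integrable_prod_ker hN measurableSet_Ioi subset_rfl (by fun_prop)
      (integrableOn_exp_neg_mul_one_add_pow hz)
  have hswap : ∀ z x : ℝ, ∫ u in Ioi (0 : ℝ), N u * (Real.exp (-(z * x)) * ker u x) =
      Real.exp (-(z * x)) * ∫ u in Ioi (0 : ℝ), N u * ker u x := by
    intro z x
    rw [← integral_const_mul]
    congr 1
    funext u
    ring
  -- The transform of the kernel integral is `8/z³` times the Stieltjes integral; requiring `z ≥ 1`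
  -- bounds this factor by `8`.
  refine eq_zero_of_laplace_le (a := 1) (C := 8 * C) (Z := max Z 1)
    (continuous_integral_mul_ker hN) ?_ ?_
  · refine ((hprod 1 one_pos).swap.integral_prod_left).congr ?_
    exact Eventually.of_forall fun x => hswap 1 x
  · intro z hz
    have hz1 : 1 ≤ z := (le_max_right _ _).trans hz
    have hz0 : 0 < z := by linarith
    have h := integral_integral_swap (hprod z hz0)
    simp only [hswap, integral_const_mul] at h
    rw [← h]
    have h1 : ∫ u in Ioi (0 : ℝ), N u * ∫ x in Ioi (0 : ℝ), Real.exp (-(z * x)) * ker u x =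
        8 / z ^ 3 * ∫ u in Ioi (0 : ℝ), N u * (u / (u ^ 2 + z ^ 2) ^ 3) := by
      rw [← integral_const_mul]
      refine setIntegral_congr_fun measurableSet_Ioi fun u hu => ?_
      have hu : 0 < u := hu
      rw [laplace_ker hu hz0, add_comm (z ^ 2)]
      field_simp
    rw [h1, abs_mul, abs_of_pos (by positivity : 0 < 8 / z ^ 3)]
    have h2 := hF z ((le_max_left _ _).trans hz)
    have h3 : 8 / z ^ 3 ≤ 8 := div_le_self (by norm_num) (one_le_pow₀ hz1)
    calc _ ≤ 8 * (C * Real.exp (-z)) := mul_le_mul h3 h2 (abs_nonneg _) (by norm_num)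
      _ = _ := by ring

open scoped ContDiff in
/-- A function whose Stieltjes transform decays like `e^{-z}` annihilates sine transforms of odd
test functions supported in `(-1, 1)`. -/
theorem integral_mul_sineTransform_eq_zero {N q : ℝ → ℝ} {C Z ρ : ℝ}
    (hN : IntegrableOn (fun u => N u / (1 + u) ^ 5) (Ioi 0))
    (hF : ∀ z, Z ≤ z → |∫ u in Ioi (0 : ℝ), N u * (u / (u ^ 2 + z ^ 2) ^ 3)| ≤
      C * Real.exp (-z))
    (hq : ContDiff ℝ ∞ q) (hodd : ∀ x, q (-x) = -q x) (hρ0 : 0 < ρ) (hρ : ρ < 1)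
    (hsupp : ∀ x, ρ ≤ x → q x = 0) :
    ∫ u in Ioi (0 : ℝ), N u * ∫ x in (0 : ℝ)..1, q x * Real.sin (u * x) = 0 := by
  obtain ⟨R, hR, hqR⟩ := exists_integral_ker_eq hq hodd hρ0 hρ hsupp
  have hwi : IntegrableOn (fun x => R x * (1 + x) ^ 7) (Ioc 0 1) :=
    (Continuous.integrableOn_Icc (by fun_prop)).mono_set Ioc_subset_Icc_self
  have h := integral_integral_swap (integrable_prod_ker hN measurableSet_Ioc
    (fun x hx => hx.1) hR hwi)
  calc _ = ∫ u in Ioi (0 : ℝ), ∫ x in Ioc (0 : ℝ) 1, N u * (R x * ker u x) := by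
        refine setIntegral_congr_fun measurableSet_Ioi fun u hu => ?_
        rw [hqR u hu, intervalIntegral.integral_of_le zero_le_one, integral_const_mul]
    _ = ∫ x in Ioc (0 : ℝ) 1, ∫ u in Ioi (0 : ℝ), N u * (R x * ker u x) := h
    _ = ∫ x in Ioo (0 : ℝ) 1, ∫ u in Ioi (0 : ℝ), N u * (R x * ker u x) :=
        integral_Ioc_eq_integral_Ioo
    _ = ∫ x in Ioo (0 : ℝ) 1, (0 : ℝ) := by
        refine setIntegral_congr_fun measurableSet_Ioo fun x hx => ?_
        have h0 := integral_mul_ker_eq_zero hN hF x hx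
        calc _ = ∫ u in Ioi (0 : ℝ), R x * (N u * ker u x) := by
              congr 1; funext u; ring
          _ = _ := by rw [integral_const_mul, h0, mul_zero]
    _ = 0 := by simp

/-! ### A nonnegative band-limited test kernel. -/

lemma integral_eq_zero_of_neg {f : ℝ → ℝ} (h : ∀ x, f (-x) = -f x) : ∫ x, f x = 0 := by
  have h1 := integral_neg_eq_self f volume
  simp only [h, integral_neg] at h1
  linarith

open FourierTransform in
lemma fourier_ofReal_re {b : ℝ → ℝ} (hb : Integrable b) (v : ℝ) :
    (𝓕 (fun x => (b x : ℂ)) v).re = ∫ x, b x * Real.cos (2 * Real.pi * v * x) := by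
  rw [Real.fourier_real_eq_integral_exp_smul]
  have hi : Integrable (fun x : ℝ => Complex.exp (↑(-2 * Real.pi * x * v) * Complex.I) •
      (b x : ℂ)) := by
    refine hb.ofReal.bdd_mul (c := 1) (Continuous.aestronglyMeasurable (by fun_prop)) ?_
    exact Eventually.of_forall fun x => by rw [Complex.norm_exp_ofReal_mul_I]
  rw [← Complex.reCLM_apply, ← Complex.reCLM.integral_comp_comm hi]
  congr 1
  funext x
  rw [Complex.reCLM_apply, smul_eq_mul, Complex.re_mul_ofReal, Complex.exp_ofReal_mul_I_re,
    mul_comm, ← Real.cos_neg]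
  congr 2
  ring

open FourierTransform in
lemma fourier_ofReal_im {b : ℝ → ℝ} (hb : Integrable b) (heven : ∀ x, b (-x) = b x) (v : ℝ) :
    (𝓕 (fun x => (b x : ℂ)) v).im = 0 := by
  rw [Real.fourier_real_eq_integral_exp_smul]
  have hi : Integrable (fun x : ℝ => Complex.exp (↑(-2 * Real.pi * x * v) * Complex.I) •
      (b x : ℂ)) := by
    refine hb.ofReal.bdd_mul (c := 1) (Continuous.aestronglyMeasurable (by fun_prop)) ?_
    exact Eventually.of_forall fun x => by rw [Complex.norm_exp_ofReal_mul_I]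
  rw [← Complex.imCLM_apply, ← Complex.imCLM.integral_comp_comm hi]
  refine integral_eq_zero_of_neg fun x => ?_
  simp only [Complex.imCLM_apply, smul_eq_mul, Complex.im_mul_ofReal, Complex.exp_ofReal_mul_I_im,
    heven]
  rw [← neg_mul, ← Real.sin_neg]
  congr 2
  ring

open FourierTransform in
open scoped ContDiff in
/-- There is a nonnegative rapidly decaying function with Fourier transform smooth and supported in
`[-1/2, 1/2]`. -/
theorem exists_testKernel : ∃ (a φ : ℝ → ℝ) (C : ℝ), ContDiff ℝ ∞ a ∧ (∀ x, a (-x) = a x) ∧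
    (∀ x, 1 / 2 ≤ |x| → a x = 0) ∧ (∀ u, φ u = ∫ x, a x * Real.cos (u * x)) ∧ Continuous φ ∧
    (∀ u, 0 ≤ φ u) ∧ 0 < φ 0 ∧ ∀ u, φ u * (1 + |u|) ^ 8 ≤ C := by
  -- The function `α` vanishes for `|x| ≥ 1/4`, so `a = α * α` vanishes for `|x| ≥ 1/2`.
  let α : ContDiffBump (0 : ℝ) := ⟨1 / 8, 1 / 4, by norm_num, by norm_num⟩
  have hαc : Continuous α := α.continuous
  have hαs : HasCompactSupport α := α.hasCompactSupport
  have hαi : Integrable α := hαc.integrable_of_hasCompactSupport hαs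
  have hαev : ∀ x, α (-x) = α x := fun x => α.neg x
  have hα0 : ∀ x : ℝ, 1 / 4 ≤ |x| → α x = 0 := fun x hx => α.zero_of_le_dist (by
    rw [Real.dist_eq, sub_zero]; exact hx)
  set αC : ℝ → ℂ := fun x => (α x : ℂ) with hαC
  have hαCs : HasCompactSupport αC := hαs.comp_left (g := fun x : ℝ => (x : ℂ)) (by simp)
  have hαCd : ContDiff ℝ ∞ αC := Complex.ofRealCLM.contDiff.comp α.contDiff
  set F : SchwartzMap ℝ ℂ := 𝓕 (hαCs.toSchwartzMap hαCd) with hFdef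
  have hF : ∀ v, F v = 𝓕 αC v := fun v => rfl
  have hFim : ∀ v, (F v).im = 0 := fun v => by rw [hF]; exact fourier_ofReal_im hαi hαev v
  set a : ℝ → ℝ := fun x => ∫ t, α t * α (x - t) with ha
  have hconv : a = convolution α α (ContinuousLinearMap.mul ℝ ℝ) volume := by
    funext x; simp [ha, convolution_def]
  have hconvC : (fun x => (a x : ℂ)) =
      convolution αC αC (ContinuousLinearMap.mul ℂ ℂ) volume := by
    funext x
    simp only [ha, convolution_def, ContinuousLinearMap.mul_apply', hαC]
    simp only [← Complex.ofReal_mul]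
    exact integral_complex_ofReal.symm
  have had : ContDiff ℝ ∞ a := by
    rw [hconv]
    exact hαs.contDiff_convolution_right _ hαi.locallyIntegrable α.contDiff
  have haev : ∀ x, a (-x) = a x := by
    intro x
    simp only [ha]
    rw [← integral_neg_eq_self]
    congr 1
    funext t
    rw [hαev, ← hαev (-x - -t)]
    congr 2
    ring
  have ha0 : ∀ x, 1 / 2 ≤ |x| → a x = 0 := by
    intro x hx
    have h : ∀ t, α t * α (x - t) = 0 := by
      intro t
      rcases le_total (1 / 4) |t| with h | h
      · rw [hα0 t h, zero_mul]
      · rw [hα0 (x - t), mul_zero]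
        have := abs_sub_abs_le_abs_sub x t
        linarith
    simp only [ha, h, integral_zero]
  have hai : Integrable a := by
    refine had.continuous.integrable_of_hasCompactSupport
      (HasCompactSupport.of_support_subset_isCompact (isCompact_Icc (a := -(1 / 2)) (b := 1 / 2))
        fun x hx => ?_)
    by_contra hcon
    refine hx (ha0 x ?_)
    by_contra hlt
    exact hcon (abs_le.1 (not_le.1 hlt).le)
  -- The transform of `α * α` is the square of that of `α`, which is real because `α` is even; hence
  -- `φ ≥ 0`. Decay comes from the Schwartz bounds.
  set φ : ℝ → ℝ := fun u => (F (u / (2 * Real.pi))).re ^ 2 with hφ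
  have hpi : 0 < 2 * Real.pi := by positivity
  have hφa : ∀ u, φ u = ∫ x, a x * Real.cos (u * x) := by
    intro u
    have h1 := fourier_ofReal_re hai (u / (2 * Real.pi))
    have h2 := Real.fourier_mul_convolution_eq (f₁ := αC) (f₂ := αC) hαi.ofReal hαi.ofReal
      (u / (2 * Real.pi))
    rw [hconvC, h2, ← hF, Complex.mul_re,
      hFim, mul_zero, sub_zero, ← sq] at h1
    rw [hφ]
    simp only
    rw [h1]
    congr 1
    funext x
    congr 2
    field_simp
  obtain ⟨C₀, hC₀, hb₀⟩ := F.decay 0 0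
  obtain ⟨C₁, hC₁, hb₁⟩ := F.decay 4 0
  simp only [norm_iteratedFDeriv_zero, pow_zero, one_mul] at hb₀ hb₁
  refine ⟨a, φ, 2 ^ 7 * (C₀ ^ 2 + ((2 * Real.pi) ^ 4 * C₁) ^ 2), had, haev, ha0, hφa,
    ?_, fun u => sq_nonneg _, ?_, fun u => ?_⟩
  · have := F.continuous
    fun_prop
  · have h1 : 0 < ∫ x, α x := α.integral_pos
    have h2 : (F 0).re = ∫ x, α x := by
      rw [hF, fourier_ofReal_re hαi]; simp
    simp only [hφ, zero_div, h2]
    positivity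
  · set v := u / (2 * Real.pi) with hv
    have huv : |u| = 2 * Real.pi * |v| := by
      rw [hv, abs_div, abs_of_pos hpi]; field_simp
    have h1 := add_pow_le zero_le_one (abs_nonneg u) 8
    have h2 : |(F v).re| ≤ C₀ := (Complex.abs_re_le_norm _).trans (hb₀ v)
    have h3 : |u| ^ 4 * |(F v).re| ≤ (2 * Real.pi) ^ 4 * C₁ := by
      rw [huv, mul_pow, mul_assoc]
      refine mul_le_mul_of_nonneg_left ?_ (by positivity)
      refine le_trans ?_ (hb₁ v)
      exact mul_le_mul_of_nonneg_left (Complex.abs_re_le_norm _) (by positivity)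
    have h4 : (F v).re ^ 2 ≤ C₀ ^ 2 := by
      rw [← sq_abs]; exact pow_le_pow_left₀ (abs_nonneg _) h2 2
    have h5 : (|u| ^ 4 * |(F v).re|) ^ 2 ≤ ((2 * Real.pi) ^ 4 * C₁) ^ 2 :=
      pow_le_pow_left₀ (by positivity) h3 2
    rw [mul_pow, sq_abs] at h5
    calc φ u * (1 + |u|) ^ 8 ≤ (F v).re ^ 2 * (2 ^ (8 - 1) * (1 ^ 8 + |u| ^ 8)) :=
          mul_le_mul_of_nonneg_left h1 (sq_nonneg _)
      _ = 2 ^ 7 * ((F v).re ^ 2 + (|u| ^ 4) ^ 2 * (F v).re ^ 2) := by norm_num; ring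
      _ ≤ _ := by gcongr

/-- The convolution of an odd function whose Stieltjes transform decays like `e^{-z}` with a test
kernel vanishes. -/
theorem integral_mul_testKernel_eq_zero {N a φ : ℝ → ℝ} {C Z x : ℝ}
    (hodd : ∀ u, 0 < u → N (-u) = -N u)
    (hN : IntegrableOn (fun u => N u / (1 + u) ^ 5) (Ioi 0))
    (hF : ∀ z, Z ≤ z → |∫ u in Ioi (0 : ℝ), N u * (u / (u ^ 2 + z ^ 2) ^ 3)| ≤
      C * Real.exp (-z))
    (ha : ContDiff ℝ (⊤ : ℕ∞) a) (haev : ∀ x, a (-x) = a x) (ha0 : ∀ x, 1 / 2 ≤ |x| → a x = 0)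
    (hφ : ∀ u, φ u = ∫ x, a x * Real.cos (u * x))
    (hi : Integrable fun s => N s * φ (s - x)) :
    ∫ s, N s * φ (s - x) = 0 := by
  have hφev : ∀ u, φ (-u) = φ u := fun u => by rw [hφ, hφ]; simp [Real.cos_neg]
  have hac : Continuous a := ha.continuous
  have hcs : HasCompactSupport a :=
    HasCompactSupport.of_support_subset_isCompact (isCompact_Icc (a := -(1 / 2)) (b := 1 / 2))
      fun y hy => by
        by_contra hcon
        refine hy (ha0 y ?_)
        by_contra hlt
        exact hcon (abs_le.1 (not_le.1 hlt).le)
  have haci : ∀ f : ℝ → ℝ, Continuous f → Integrable fun y => a y * f y := fun f hf =>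
    (hac.mul hf).integrable_of_hasCompactSupport hcs.mul_right
  -- This difference appears when the integral over `s < 0` is folded onto `s > 0` by oddness of
  -- `N`. It is the sine transform in `s` of an odd test function.
  have hdiff : ∀ s, φ (s - x) - φ (s + x) =
      ∫ y in (0 : ℝ)..1, (4 * (a y * Real.sin (x * y))) * Real.sin (s * y) := by
    intro s
    rw [hφ, hφ, ← integral_sub (haci _ (by fun_prop)) (haci _ (by fun_prop))]
    have h1 : ∀ y, a y * Real.cos ((s - x) * y) - a y * Real.cos ((s + x) * y) =
        2 * (a y * Real.sin (x * y) * Real.sin (s * y)) := by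
      intro y
      rw [sub_mul, add_mul, Real.cos_sub, Real.cos_add]
      ring
    simp only [h1]
    have hint : Integrable fun y => 2 * (a y * Real.sin (x * y) * Real.sin (s * y)) := by
      simpa only [← mul_assoc] using
        ((haci (fun y => Real.sin (x * y) * Real.sin (s * y)) (by fun_prop)).const_mul 2)
    rw [← integral_add_compl measurableSet_Ioi hint (s := Ioi 0), compl_Ioi,
      show (Iic (0 : ℝ)) = Iic (-0) by simp, ← integral_comp_neg_Ioi]
    simp only [haev, mul_neg, neg_mul, Real.sin_neg, neg_neg]
    have h2 : ∫ y in Ioi (0 : ℝ), 2 * (a y * Real.sin (x * y) * Real.sin (s * y)) =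
        ∫ y in (0 : ℝ)..1, 2 * (a y * Real.sin (x * y) * Real.sin (s * y)) := by
      rw [intervalIntegral.integral_of_le zero_le_one]
      refine (setIntegral_eq_of_subset_of_forall_sdiff_eq_zero measurableSet_Ioi
        Ioc_subset_Ioi_self fun y hy => ?_)
      have hy1 : 1 < y := by
        by_contra hcon
        exact hy.2 ⟨hy.1, not_lt.1 hcon⟩
      rw [ha0 y (by rw [abs_of_pos (by linarith)]; linarith)]
      ring
    rw [h2, ← two_mul, ← intervalIntegral.integral_const_mul]
    congr 1
    funext y
    ring
  have hmain := integral_mul_sineTransform_eq_zero (q := fun y => 4 * (a y * Real.sin (x * y)))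
    (ρ := 1 / 2) hN hF (by
      have := Real.contDiff_sin (n := (⊤ : ℕ∞))
      fun_prop)
    (fun y => by simp [haev, Real.sin_neg]) (by norm_num) (by norm_num)
    (fun y hy => by rw [ha0 y (hy.trans (le_abs_self y))]; ring)
  rw [← integral_add_compl measurableSet_Ioi hi (s := Ioi 0), compl_Ioi,
      show (Iic (0 : ℝ)) = Iic (-0) by simp, ← integral_comp_neg_Ioi]
  have hi2 : IntegrableOn (fun s => N (-s) * φ (-s - x)) (Ioi 0) :=
    (hi.comp_neg).integrableOn
  rw [← integral_add hi.integrableOn hi2]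
  refine Eq.trans ?_ hmain
  refine setIntegral_congr_fun measurableSet_Ioi fun s hs => ?_
  rw [← hdiff, hodd s hs, show -s - x = -(s + x) by ring, hφev]
  ring

/-! ### The one-sided Tauberian argument. -/

lemma abs_sub_le_of_local {f : ℝ → ℝ} {B η R : ℝ} (hη : 0 < η) (hB : 0 ≤ B)
    (hf : ∀ x y, x ≤ y → y ≤ x + η → |f y - f x| ≤ B * (1 + x ^ 2)) (n : ℕ) :
    ∀ a b, |a| ≤ R → |b| ≤ R → a ≤ b → b ≤ a + n * η →
      |f b - f a| ≤ n * (B * (1 + R ^ 2)) := by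
  have hw : ∀ x, |x| ≤ R → B * (1 + x ^ 2) ≤ B * (1 + R ^ 2) := fun x hx => by
    have := sq_le_sq' (abs_le.1 hx).1 (abs_le.1 hx).2
    gcongr
  induction n with
  | zero =>
    intro a b _ _ hab hb
    have : a = b := le_antisymm hab (by simpa using hb)
    simp [this]
  | succ n ih =>
    intro a b ha hb hab hbn
    push_cast at hbn ⊢
    have hR : 0 ≤ B * (1 + R ^ 2) := by positivity
    rcases le_total b (a + η) with h | h
    · have h1 := (hf a b hab h).trans (hw a ha)
      have : 0 ≤ (n : ℝ) * (B * (1 + R ^ 2)) := by positivity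
      linarith
    · have hm : |a + η| ≤ R := abs_le.2 ⟨by have := (abs_le.1 ha).1; linarith,
        by have := (abs_le.1 hb).2; linarith⟩
      have h1 := ih (a + η) b hm hb h (by linarith)
      have h2 := (hf a (a + η) (by linarith) le_rfl).trans (hw a ha)
      have h3 : f b - f a = (f b - f (a + η)) + (f (a + η) - f a) := by ring
      rw [h3]
      refine (abs_add_le _ _).trans ?_
      linarith

/-- Decay of order `8` leaves two spare powers, and `(1+|s|)⁻²` is integrable. -/
lemma integrable_pow_mul_of_decay {φ : ℝ → ℝ} {C : ℝ} (hφc : Continuous φ) (hφ0 : ∀ u, 0 ≤ φ u)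
    (hφ : ∀ u, φ u * (1 + |u|) ^ 8 ≤ C) : Integrable fun s => (1 + |s|) ^ 6 * φ s := by
  have h := (integrable_one_add_norm (E := ℝ) (μ := volume) (r := 2) (by simp)).const_mul C
  refine Integrable.mono' h (Continuous.aestronglyMeasurable (by fun_prop))
    (Eventually.of_forall fun s => ?_)
  have hs : 0 < 1 + |s| := by positivity
  rw [Real.norm_of_nonneg (mul_nonneg (by positivity) (hφ0 s)), Real.norm_eq_abs,
    Real.rpow_neg hs.le, Real.rpow_ofNat, ← div_eq_mul_inv, le_div_iff₀ (by positivity)]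
  calc _ = φ s * (1 + |s|) ^ 8 := by ring
    _ ≤ C := hφ s

/-- One-sided Tauberian theorem: a function annihilated by all translates of a nonnegative kernel
and not decreasing too fast is `O(1 + x²)`. -/
theorem exists_abs_le_of_annihilated {φ : ℝ → ℝ} {C : ℝ} (hφc : Continuous φ)
    (hφ0 : ∀ u, 0 ≤ φ u) (hpos : 0 < φ 0) (hφ : ∀ u, φ u * (1 + |u|) ^ 8 ≤ C) :
    ∃ C' : ℝ, 0 < C' ∧ ∀ (N : ℝ → ℝ) (K : ℝ), 0 ≤ K →
      (∀ x, Integrable fun s => N s * φ (s - x)) → (∀ x, ∫ s, N s * φ (s - x) = 0) →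
      (∀ u v, u ≤ v → v ≤ u + 1 → -(K * (1 + u ^ 2)) ≤ N v - N u) →
      ∀ x, |N x| ≤ C' * (K * (1 + x ^ 2)) := by
  obtain ⟨η, hη0, hη2, hηφ⟩ : ∃ η : ℝ, 0 < η ∧ η ≤ 1 / 2 ∧ ∀ s, |s| ≤ η → φ 0 / 2 ≤ φ s := by
    have h1 : ∀ᶠ s in nhds (0 : ℝ), φ 0 / 2 < φ s :=
      hφc.continuousAt.eventually (lt_mem_nhds (by linarith))
    obtain ⟨ε, hε, h⟩ := Metric.eventually_nhds_iff.1 h1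
    refine ⟨min (ε / 2) (1 / 2), by positivity, min_le_right _ _, fun s hs => (h ?_).le⟩
    rw [Real.dist_eq, sub_zero]
    have := min_le_left (ε / 2) (1 / 2)
    linarith
  have hi6 := integrable_pow_mul_of_decay hφc hφ0 hφ
  have hik : ∀ k : ℕ, k ≤ 6 → Integrable fun s => (1 + |s|) ^ k * φ s := by
    intro k hk
    refine Integrable.mono' hi6 (Continuous.aestronglyMeasurable (by fun_prop))
      (Eventually.of_forall fun s => ?_)
    rw [Real.norm_of_nonneg (mul_nonneg (by positivity) (hφ0 s))]
    exact mul_le_mul_of_nonneg_right (pow_le_pow_right₀ (by linarith [abs_nonneg s]) hk) (hφ0 s)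
  set m := ∫ s, (1 + |s|) ^ 6 * φ s with hm
  have hmk : ∀ k : ℕ, k ≤ 6 → ∫ s, (1 + |s|) ^ k * φ s ≤ m := fun k hk =>
    integral_mono (hik k hk) hi6 fun s =>
      mul_le_mul_of_nonneg_right (pow_le_pow_right₀ (by linarith [abs_nonneg s]) hk) (hφ0 s)
  have hiφ : Integrable φ := by simpa using hik 0 (by norm_num)
  have hm0 : 0 < ∫ s, φ s := integral_pos_of_integrable_nonneg_nonzero hφc hiφ hφ0 hpos.ne'
  have hm_nn : 0 ≤ m := integral_nonneg fun s => mul_nonneg (by positivity) (hφ0 s)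
  have hm_pos : 0 < m := hm0.trans_le (by simpa using hmk 0 (by norm_num))
  set Q := 2 * m / (η * (φ 0 / 2)) + 6 with hQ
  have hQ0 : 0 ≤ Q := by positivity
  refine ⟨2 * (Q + 3) / η * m / ∫ s, φ s, by positivity, ?_⟩
  intro N K hK hint hzero hmono x
  have hsq : ∀ x y : ℝ, |y| ≤ |x| + 1 → 1 + y ^ 2 ≤ 3 * (1 + x ^ 2) := by
    intro x y hy
    have h1 : y ^ 2 ≤ (|x| + 1) ^ 2 := sq_le_sq' (by linarith [neg_abs_le y]) ((le_abs_self y).trans hy)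
    nlinarith [sq_abs x, sq_nonneg (|x| - 1)]
  have hKsq : ∀ x y : ℝ, |y| ≤ |x| + 1 → K * (1 + y ^ 2) ≤ 3 * (K * (1 + x ^ 2)) := by
    intro x y hy
    have := mul_le_mul_of_nonneg_left (hsq x y hy) hK
    linarith
  -- an upper bound for the increments over an interval of length `η`
  have hup : ∀ x, N (x + η) - N x ≤ Q * (K * (1 + x ^ 2)) := by
    intro x
    set W := K * (1 + x ^ 2) with hW
    have hW0 : 0 ≤ W := by positivity
    set h := 2 * η with hh
    have i1 : Integrable fun s => N (s + h) * φ (s - x) := by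
      refine ((hint (x + h)).comp_add_right h).congr (Eventually.of_forall fun s => ?_)
      simp only
      congr 2
      ring
    have e1 : ∫ s, N (s + h) * φ (s - x) = 0 := by
      have h1 := integral_add_right_eq_self (μ := volume) (fun s => N s * φ (s - (x + h))) h
      rw [hzero (x + h)] at h1
      rw [← h1]
      congr 1
      funext s
      congr 2
      ring
    have hbd : ∀ s, (1 + s ^ 2) * φ (s - x) ≤
        2 * (1 + x ^ 2) * ((1 + |s - x|) ^ 2 * φ (s - x)) := by
      intro s
      rw [← mul_assoc]
      refine mul_le_mul_of_nonneg_right ?_ (hφ0 _)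
      have h1 : (1 + (s - x) ^ 2) ≤ (1 + |s - x|) ^ 2 := by
        nlinarith [sq_abs (s - x), abs_nonneg (s - x)]
      have h2 : 1 + s ^ 2 ≤ 2 * (1 + x ^ 2) * (1 + (s - x) ^ 2) := by
        nlinarith [sq_nonneg (s - 2 * x), sq_nonneg (x * (s - x))]
      exact h2.trans (mul_le_mul_of_nonneg_left h1 (by positivity))
    have i2' : Integrable fun s => (1 + |s - x|) ^ 2 * φ (s - x) :=
      (hik 2 (by norm_num)).comp_sub_right x
    have i2 : Integrable fun s => (1 + s ^ 2) * φ (s - x) := by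
      refine Integrable.mono' (i2'.const_mul (2 * (1 + x ^ 2)))
        (Continuous.aestronglyMeasurable (by fun_prop)) (Eventually.of_forall fun s => ?_)
      rw [Real.norm_of_nonneg (mul_nonneg (by positivity) (hφ0 _))]
      exact hbd s
    have e2 : ∫ s, (1 + s ^ 2) * φ (s - x) ≤ 2 * (1 + x ^ 2) * m := by
      refine (integral_mono i2 (i2'.const_mul _) hbd).trans ?_
      rw [integral_const_mul, integral_sub_right_eq_self (fun s => (1 + |s|) ^ 2 * φ s)]
      exact mul_le_mul_of_nonneg_left (hmk 2 (by norm_num)) (by positivity)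
    set G : ℝ → ℝ := fun s => N (s + h) * φ (s - x) - N s * φ (s - x) +
      K * ((1 + s ^ 2) * φ (s - x)) with hG
    have iG : Integrable G := (i1.sub (hint x)).add (i2.const_mul K)
    have eG : ∫ s, G s ≤ 2 * m * W := by
      have h1 : ∫ s, G s = (∫ s, (N (s + h) * φ (s - x) - N s * φ (s - x))) +
          ∫ s, K * ((1 + s ^ 2) * φ (s - x)) := integral_add (i1.sub (hint x)) (i2.const_mul K)
      rw [h1, integral_sub i1 (hint x), e1, hzero x, integral_const_mul]
      have := mul_le_mul_of_nonneg_left e2 hK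
      calc _ ≤ K * (2 * (1 + x ^ 2) * m) := by linarith
        _ = _ := by rw [hW]; ring
    have hG' : ∀ s, G s = (N (s + h) - N s + K * (1 + s ^ 2)) * φ (s - x) := fun s => by
      simp only [hG]; ring
    have hG0 : ∀ s, 0 ≤ G s := fun s => by
      rw [hG']
      refine mul_nonneg ?_ (hφ0 _)
      have := hmono s (s + h) (by linarith) (by linarith)
      linarith
    by_cases hD : N (x + η) - N x ≤ 6 * W
    · refine hD.trans (mul_le_mul_of_nonneg_right ?_ hW0)
      have : 0 ≤ 2 * m / (η * (φ 0 / 2)) := by positivity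
      linarith
    · have hD' := not_le.1 hD
      have hGl : ∀ s ∈ Icc (x - η) x, (N (x + η) - N x - 6 * W) * (φ 0 / 2) ≤ G s := by
        intro s hs
        rw [hG']
        have hsx : |s - x| ≤ η := abs_le.2 ⟨by linarith [hs.1], by linarith [hs.2]⟩
        have hs1 : |s| ≤ |x| + 1 := by
          have := abs_sub_abs_le_abs_sub s x
          linarith
        have hx1 : |x + η| ≤ |x| + 1 := by
          have := abs_add_le x η
          rw [abs_of_pos hη0] at this
          linarith
        have h1 := hmono s x hs.2 (by linarith [hs.1])
        have h2 := hmono (x + η) (s + h) (by linarith [hs.1]) (by linarith [hs.2])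
        have h3 := hKsq x s hs1
        have h4 := hKsq x (x + η) hx1
        have h5 : 0 ≤ K * (1 + s ^ 2) := by positivity
        refine mul_le_mul ?_ (hηφ _ hsx) (by positivity) ?_ <;> linarith
      have h6 : η * ((N (x + η) - N x - 6 * W) * (φ 0 / 2)) ≤ ∫ s, G s := by
        refine le_trans ?_ (setIntegral_le_integral iG (Eventually.of_forall hG0)
          (s := Icc (x - η) x))
        have h7 := setIntegral_mono_on
          (integrableOn_const (C := (N (x + η) - N x - 6 * W) * (φ 0 / 2))
            (by simp : volume (Icc (x - η) x) ≠ ⊤)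
            enorm_ne_top) iG.integrableOn
          measurableSet_Icc hGl
        rw [setIntegral_const] at h7
        simpa [hη0.le] using h7
      have h8 := h6.trans eG
      have h9 : (N (x + η) - N x - 6 * W) ≤ 2 * m * W / (η * (φ 0 / 2)) := by
        rw [le_div_iff₀ (by positivity)]
        linarith
      rw [hQ, add_mul, div_mul_eq_mul_div]
      linarith
  have hloc : ∀ x y, x ≤ y → y ≤ x + η → |N y - N x| ≤ ((Q + 3) * K) * (1 + x ^ 2) := by
    intro x y hxy hyx
    have hy1 : |y| ≤ |x| + 1 := by
      have := abs_sub_abs_le_abs_sub y x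
      rw [abs_of_nonneg (by linarith : 0 ≤ y - x)] at this
      linarith
    have h1 := hup x
    have h2 := hmono y (x + η) hyx (by linarith)
    have h3 := hKsq x y hy1
    have h4 := hmono x y hxy (by linarith)
    have h5 : 0 ≤ K * (1 + x ^ 2) := by positivity
    have h6 : 0 ≤ Q * (K * (1 + x ^ 2)) := by positivity
    rw [abs_le]
    constructor <;> linarith
  -- Chain `⌈|s-x|/η⌉` local steps. The cube is one power for the number of steps and two for the
  -- quadratic weight.
  have hglob : ∀ s, |N x - N s| ≤
      2 * (Q + 3) / η * (K * (1 + x ^ 2)) * (1 + |s - x|) ^ 3 := by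
    intro s
    have hQK : 0 ≤ (Q + 3) * K := by positivity
    have hR1 : |x| ≤ |x| + |s - x| := by linarith [abs_nonneg (s - x)]
    have hR2 : |s| ≤ |x| + |s - x| := by
      have := abs_sub_abs_le_abs_sub s x
      linarith
    obtain hn := Nat.ceil_lt_add_one (a := |s - x| / η) (by positivity)
    have hn2 := Nat.le_ceil (|s - x| / η)
    set n := ⌈|s - x| / η⌉₊
    rw [div_le_iff₀ hη0] at hn2
    have key : |N x - N s| ≤ n * (((Q + 3) * K) * (1 + (|x| + |s - x|) ^ 2)) := by
      rcases le_total x s with h | h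
      · rw [abs_sub_comm]
        rw [abs_of_nonneg (by linarith : 0 ≤ s - x)] at hn2
        exact abs_sub_le_of_local hη0 hQK hloc n x s hR1 hR2 h (by linarith)
      · rw [abs_of_nonpos (by linarith : s - x ≤ 0)] at hn2
        exact abs_sub_le_of_local hη0 hQK hloc n s x hR2 hR1 h (by linarith)
    have hn3 : (n : ℝ) ≤ (1 + |s - x|) / η := by
      rw [add_div]
      have : 1 ≤ 1 / η := by rw [le_div_iff₀ hη0]; linarith
      linarith
    have hR3 : 1 + (|x| + |s - x|) ^ 2 ≤ 2 * (1 + x ^ 2) * (1 + |s - x|) ^ 2 := by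
      set t := |s - x|
      have ht : 0 ≤ t := abs_nonneg _
      have h1 : 1 + (|x| + t) ^ 2 ≤ 2 * (1 + x ^ 2) * (1 + t ^ 2) := by
        nlinarith [sq_nonneg (|x| - t), sq_abs x, sq_nonneg (x * t)]
      refine h1.trans (mul_le_mul_of_nonneg_left ?_ (by positivity))
      nlinarith
    calc _ ≤ n * (((Q + 3) * K) * (1 + (|x| + |s - x|) ^ 2)) := key
      _ ≤ (1 + |s - x|) / η * (((Q + 3) * K) * (2 * (1 + x ^ 2) * (1 + |s - x|) ^ 2)) := by
        gcongr
      _ = _ := by ring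
  have i3 : Integrable fun s => N x * φ (s - x) := (hiφ.comp_sub_right x).const_mul _
  have i4 : Integrable fun s => (1 + |s - x|) ^ 3 * φ (s - x) :=
    (hik 3 (by norm_num)).comp_sub_right x
  -- The `φ`-average of `N` around `x` vanishes, so `N x` is recovered from its oscillation alone.
  have e3 : N x * ∫ s, φ s = ∫ s, (N x * φ (s - x) - N s * φ (s - x)) := by
    rw [integral_sub i3 (hint x), hzero x, integral_const_mul, integral_sub_right_eq_self, sub_zero]
  have e4 : |N x * ∫ s, φ s| ≤ 2 * (Q + 3) / η * (K * (1 + x ^ 2)) * m := by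
    rw [e3, ← Real.norm_eq_abs]
    refine (norm_integral_le_of_norm_le (i4.const_mul (2 * (Q + 3) / η * (K * (1 + x ^ 2))))
      (Eventually.of_forall fun s => ?_)).trans ?_
    · rw [← sub_mul, norm_mul, Real.norm_of_nonneg (hφ0 _), ← mul_assoc]
      exact mul_le_mul_of_nonneg_right (hglob s) (hφ0 _)
    · rw [integral_const_mul, integral_sub_right_eq_self (fun s => (1 + |s|) ^ 3 * φ s)]
      exact mul_le_mul_of_nonneg_left (hmk 3 (by norm_num)) (by positivity)
  rw [abs_mul, abs_of_pos hm0] at e4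
  rw [div_mul_eq_mul_div, le_div_iff₀ hm0]
  linarith

/-- Reflection, the origin being a null set. Oddness is asked only off `0` because `oddLift` takes
the value `A 0` there. -/
lemma integrable_of_odd_of_integrableOn_Ioi {w : ℝ → ℝ} (hodd : ∀ u, 0 < u → w (-u) = -w u)
    (hw : IntegrableOn w (Ioi 0)) : Integrable w := by
  have h1 : IntegrableOn w (Iio 0) := by
    have h2 := (Measure.measurePreserving_neg (volume : Measure ℝ)).integrableOn_comp_preimage
      (Homeomorph.neg ℝ).measurableEmbedding (f := fun u => -w u) (s := Ioi 0)
    have h3 := h2.2 hw.neg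
    simp only [neg_preimage, neg_Ioi, neg_zero] at h3
    refine h3.congr_fun (fun u hu => ?_) measurableSet_Iio
    have h4 := hodd (-u) (by simpa using hu)
    simp only [Function.comp_apply, neg_neg] at h4 ⊢
    linarith
  rw [← integrableOn_univ, ← Iic_union_Ioi (a := (0 : ℝ)), integrableOn_union,
    integrableOn_Iic_iff_integrableOn_Iio]
  exact ⟨h1, hw⟩

/-- By `1+|s| ≤ (1+|x|)(1+|s-x|)`, the decay of the translated kernel compensates the weight
`(1+|s|)⁵`. -/
lemma integrable_mul_comp_sub {N φ : ℝ → ℝ} {C : ℝ}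
    (hodd : ∀ u, 0 < u → N (-u) = -N u)
    (hN : IntegrableOn (fun u => N u / (1 + u) ^ 5) (Ioi 0)) (hφc : Continuous φ)
    (hφ0 : ∀ u, 0 ≤ φ u) (hφ : ∀ u, φ u * (1 + |u|) ^ 8 ≤ C) (x : ℝ) :
    Integrable fun s => N s * φ (s - x) := by
  have h1 : Integrable fun u => N u / (1 + |u|) ^ 5 := by
    refine integrable_of_odd_of_integrableOn_Ioi (fun u hu => ?_) ?_
    · rw [hodd u hu, abs_neg, neg_div]
    · exact hN.congr_fun (fun u hu => by simp only [abs_of_pos (show 0 < u from hu)])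
        measurableSet_Ioi
  have h2 : (fun s => N s * φ (s - x)) =
      fun s => ((1 + |s|) ^ 5 * φ (s - x)) * (N s / (1 + |s|) ^ 5) := by
    funext s
    have : 0 < 1 + |s| := by positivity
    field_simp
  rw [h2]
  refine h1.bdd_mul (c := (1 + |x|) ^ 5 * C) (Continuous.aestronglyMeasurable (by fun_prop))
    (Eventually.of_forall fun s => ?_)
  rw [Real.norm_of_nonneg (mul_nonneg (by positivity) (hφ0 _))]
  have h3 : 1 + |s| ≤ (1 + |x|) * (1 + |s - x|) := by
    have := abs_sub_abs_le_abs_sub s x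
    nlinarith [abs_nonneg x, abs_nonneg (s - x), mul_nonneg (abs_nonneg x) (abs_nonneg (s - x))]
  have h4 : (1 + |s - x|) ^ 5 ≤ (1 + |s - x|) ^ 8 :=
    pow_le_pow_right₀ (by linarith [abs_nonneg (s - x)]) (by norm_num)
  calc (1 + |s|) ^ 5 * φ (s - x)
      ≤ ((1 + |x|) * (1 + |s - x|)) ^ 5 * φ (s - x) :=
        mul_le_mul_of_nonneg_right (pow_le_pow_left₀ (by positivity) h3 5) (hφ0 _)
    _ = (1 + |x|) ^ 5 * (φ (s - x) * (1 + |s - x|) ^ 5) := by ring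
    _ ≤ (1 + |x|) ^ 5 * (φ (s - x) * (1 + |s - x|) ^ 8) := by
        have := hφ0 (s - x)
        gcongr
    _ ≤ _ := mul_le_mul_of_nonneg_left (hφ _) (by positivity)

/-- Tauberian theorem for odd functions whose Stieltjes transform decays like `e^{-z}`. -/
theorem exists_abs_le_of_stieltjes_le :
    ∃ C : ℝ, 0 < C ∧ ∀ (N : ℝ → ℝ) (K D Z : ℝ), 0 ≤ K → (∀ u, 0 < u → N (-u) = -N u) →
      IntegrableOn (fun u => N u / (1 + u) ^ 5) (Ioi 0) →
      (∀ z, Z ≤ z → |∫ u in Ioi (0 : ℝ), N u * (u / (u ^ 2 + z ^ 2) ^ 3)| ≤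
        D * Real.exp (-z)) →
      (∀ u v, u ≤ v → v ≤ u + 1 → -(K * (1 + u ^ 2)) ≤ N v - N u) →
      ∀ x, |N x| ≤ C * (K * (1 + x ^ 2)) := by
  obtain ⟨a, φ, Cφ, ha, haev, ha0, hφa, hφc, hφ0, hpos, hφ⟩ := exists_testKernel
  obtain ⟨C, hC, h⟩ := exists_abs_le_of_annihilated hφc hφ0 hpos hφ
  refine ⟨C, hC, fun N K D Z hK hodd hN hF hmono => ?_⟩
  have hi := integrable_mul_comp_sub hodd hN hφc hφ0 hφ
  exact h N K hK hi
    (fun x => integral_mul_testKernel_eq_zero hodd hN hF ha haev ha0 hφa (hi x)) hmono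

/-! ### Increments of the total function and its odd lift. -/

/-- If `|B t|` exceeded the essential supremum, right-continuity would keep it above on an interval
of positive length. Recovering `B (u²)` from `u³ B (u²)` needs `t > 0`. -/
lemma abs_le_linftyNorm {B : ℝ → ℝ} {M : ℝ} (hM : ∀ t, 0 ≤ t → |B t| ≤ M)
    (hB : RightContinuous fun u => u ^ 3 * B (u ^ 2)) {t : ℝ} (ht : 0 < t) :
    |B t| ≤ linftyNorm B := by
  by_contra hcon
  have hlt := not_le.1 hcon
  set μ : Measure ℝ := volume.restrict (Ici 0)
  have hfin : eLpNorm B ∞ μ ≠ ∞ := by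
    have h1 : ∀ᵐ s ∂μ, ‖B s‖ ≤ M :=
      (ae_restrict_iff' measurableSet_Ici).2 (Eventually.of_forall fun s hs => hM s hs)
    rw [eLpNorm_exponent_top]
    exact ((eLpNormEssSup_le_of_ae_bound h1).trans_lt ENNReal.ofReal_lt_top).ne
  have hae : ∀ᵐ s ∂μ, |B s| ≤ linftyNorm B := by
    have h1 : ∀ᵐ s ∂μ, ‖B s‖ₑ ≤ eLpNorm B ∞ μ := by
      rw [eLpNorm_exponent_top]; exact ae_le_eLpNormEssSup
    filter_upwards [h1] with s hs
    have h2 := ENNReal.toReal_mono hfin hs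
    simpa [linftyNorm] using h2
  have hae' : ∀ᵐ s, s ∈ Ici (0 : ℝ) → |B s| ≤ linftyNorm B :=
    (ae_restrict_iff' measurableSet_Ici).1 hae
  set u := Real.sqrt t with hu
  have hu0 : 0 < u := Real.sqrt_pos.2 ht
  have hut : u ^ 2 = t := Real.sq_sqrt ht.le
  have hcont : ContinuousWithinAt (fun w => B (w ^ 2)) (Ioi u) u := by
    have h1 : ContinuousWithinAt (fun w => w ^ 3 * B (w ^ 2) / w ^ 3) (Ioi u) u :=
      (hB u hu0.le).div (by fun_prop) (by positivity)
    refine h1.congr_of_eventuallyEq ?_ (by field_simp)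
    filter_upwards [self_mem_nhdsWithin] with w hw
    have : 0 < w := hu0.trans hw
    field_simp
  have hev : ∀ᶠ w in nhdsWithin u (Ioi u), linftyNorm B < |B (w ^ 2)| :=
    hcont.abs.eventually (lt_mem_nhds (by simpa only [hut] using hlt))
  obtain ⟨b, hb, hsub⟩ := (mem_nhdsGT_iff_exists_Ioo_subset).1 hev
  have hub : u < b := hb
  have hnull : volume (Ioo (u ^ 2) (b ^ 2)) = 0 := by
    refine measure_mono_null (fun s hs => ?_) hae'
    have hs0 : 0 < s := lt_trans (by positivity) hs.1
    have h1 : Real.sqrt s ∈ Ioo u b :=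
      ⟨Real.lt_sqrt_of_sq_lt hs.1, (Real.sqrt_lt' (hu0.trans hub)).2 hs.2⟩
    have h2 : linftyNorm B < |B (Real.sqrt s ^ 2)| := hsub h1
    rw [Real.sq_sqrt hs0.le] at h2
    simp only [mem_compl_iff, mem_ofPred_eq, not_forall]
    exact ⟨hs0.le, not_le.2 h2⟩
  rw [Real.volume_Ioo, ENNReal.ofReal_eq_zero] at hnull
  nlinarith

lemma total_sq (B₀ B₁ B₂ : ℝ → ℝ) {u : ℝ} (hu : 0 ≤ u) :
    total B₀ B₁ B₂ (u ^ 2) = u ^ 3 * B₀ (u ^ 2) + B₁ (u ^ 2) + B₂ (u ^ 2) := by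
  have h : (u ^ 2) ^ (3 / 2 : ℝ) = u ^ 3 := by
    rw [← Real.rpow_natCast u 2, ← Real.rpow_mul hu, ← Real.rpow_natCast u 3]
    norm_num
  rw [total, h]
  ring

/-- On one step of length at most `δ`, write the increment as `(v³-u³) B(v²) + u² · u(B(v²)-B(u²))`.
Chaining `n` steps telescopes the cubes and repeats the defect. -/
lemma cube_mul_sub_ge {B : ℝ → ℝ} {δ M D : ℝ} (hM : ∀ t, 0 < t → |B t| ≤ M)
    (hD0 : 0 ≤ D) (hδ : 0 < δ)
    (hD : ∀ u v, 0 ≤ u → u ≤ v → v ≤ u + δ → -D ≤ u * (B (v ^ 2) - B (u ^ 2))) (n : ℕ) :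
    ∀ u v, 0 ≤ u → u ≤ v → v ≤ u + n * δ →
      -(M * (v ^ 3 - u ^ 3) + n * (v ^ 2 * D)) ≤ v ^ 3 * B (v ^ 2) - u ^ 3 * B (u ^ 2) := by
  have hstep : ∀ u v, 0 ≤ u → u ≤ v → v ≤ u + δ →
      -(M * (v ^ 3 - u ^ 3) + v ^ 2 * D) ≤ v ^ 3 * B (v ^ 2) - u ^ 3 * B (u ^ 2) := by
    intro u v hu huv hv
    -- `B 0` is not controlled by the essential supremum, but the factor `u³` removes it.
    rcases hu.eq_or_lt with rfl | hu0
    · rcases huv.eq_or_lt with rfl | hv0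
      · simp
      · have h1 := mul_le_mul_of_nonneg_left (abs_le.1 (hM (v ^ 2) (by positivity))).1
          (by positivity : 0 ≤ v ^ 3)
        have h2 : 0 ≤ v ^ 2 * D := by positivity
        nlinarith
    · have h3 : 0 ≤ v ^ 3 - u ^ 3 := sub_nonneg.2 (pow_le_pow_left₀ hu huv 3)
      have h1 := mul_le_mul_of_nonneg_left (abs_le.1 (hM (v ^ 2)
        (by have : 0 < v := hu0.trans_le huv
            positivity))).1 h3
      have h4 := mul_le_mul_of_nonneg_left (hD u v hu huv hv) (sq_nonneg u)
      have h5 := mul_le_mul_of_nonneg_right (pow_le_pow_left₀ hu huv 2) hD0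
      nlinarith
  induction n with
  | zero =>
    intro u v hu huv hv
    have : u = v := le_antisymm huv (by simpa using hv)
    simp [this]
  | succ n ih =>
    intro u v hu huv hv
    push_cast at hv ⊢
    rcases le_total v (u + δ) with h | h
    · have h1 := hstep u v hu huv h
      have : 0 ≤ n * (v ^ 2 * D) := by positivity
      linarith
    · have h1 := ih (u + δ) v (by positivity) h (by linarith)
      have h2 := hstep u (u + δ) hu (by linarith) le_rfl
      have h3 := mul_le_mul_of_nonneg_right
        (pow_le_pow_left₀ (by positivity : 0 ≤ u + δ) h 2) hD0
      linarith

lemma total_sq_sub_ge {B₀ B₁ B₂ : ℝ → ℝ} {δ t₀ M D E L : ℝ} (hM0 : 0 ≤ M)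
    (hM : ∀ t, 0 < t → |B₀ t| ≤ M) (hD0 : 0 ≤ D) (hδ : 0 < δ)
    (hD : ∀ u v, 0 ≤ u → u ≤ v → v ≤ u + δ → -D ≤ u * (B₀ (v ^ 2) - B₀ (u ^ 2)))
    (hB₁ : MonotoneOn B₁ (Ici 0)) (hB₂ : ∀ t, 0 ≤ t → |B₂ t| ≤ E * (t₀ + t)) (hL : 0 ≤ L)
    {u v : ℝ} (hu : 0 ≤ u) (huv : u ≤ v) (hv : v ≤ u + L) :
    -(3 * M * L * v ^ 2 + (L / δ + 1) * (v ^ 2 * D) + E * (2 * t₀ + u ^ 2 + v ^ 2)) ≤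
      total B₀ B₁ B₂ (v ^ 2) - total B₀ B₁ B₂ (u ^ 2) := by
  have hv0 := hu.trans huv
  rw [total_sq _ _ _ hu, total_sq _ _ _ hv0]
  have hn := Nat.ceil_lt_add_one (a := L / δ) (by positivity)
  have hn2 := Nat.le_ceil (L / δ)
  rw [div_le_iff₀ hδ] at hn2
  have h1 := cube_mul_sub_ge hM hD0 hδ hD ⌈L / δ⌉₊ u v hu huv (by linarith)
  have h2 := hB₁ (sq_nonneg u : u ^ 2 ∈ Ici 0) (sq_nonneg v : v ^ 2 ∈ Ici 0)
    (pow_le_pow_left₀ hu huv 2)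
  have h3 := (abs_le.1 (hB₂ _ (sq_nonneg u))).2
  have h4 := (abs_le.1 (hB₂ _ (sq_nonneg v))).1
  have h5 : (⌈L / δ⌉₊ : ℝ) * (v ^ 2 * D) ≤ (L / δ + 1) * (v ^ 2 * D) :=
    mul_le_mul_of_nonneg_right hn.le (by positivity)
  have h6 : v ^ 3 - u ^ 3 ≤ 3 * L * v ^ 2 := by
    have h7 : v ^ 3 - u ^ 3 = (v - u) * (v ^ 2 + v * u + u ^ 2) := by ring
    have h8 : v ^ 2 + v * u + u ^ 2 ≤ 3 * v ^ 2 := by nlinarith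
    rw [h7]
    calc _ ≤ L * (3 * v ^ 2) := mul_le_mul (by linarith) h8 (by positivity) hL
      _ = _ := by ring
  have h9 := mul_le_mul_of_nonneg_left h6 hM0
  linarith

/-- The odd function equal to `A (u² / ε²)` for `u ≥ 0`. -/
noncomputable def oddLift (A : ℝ → ℝ) (ε u : ℝ) : ℝ :=
  if 0 ≤ u then A ((u / ε) ^ 2) else -A ((u / ε) ^ 2)

lemma oddLift_of_nonneg (A : ℝ → ℝ) (ε : ℝ) {u : ℝ} (hu : 0 ≤ u) :
    oddLift A ε u = A ((u / ε) ^ 2) := if_pos hu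

lemma oddLift_of_neg (A : ℝ → ℝ) (ε : ℝ) {u : ℝ} (hu : u < 0) :
    oddLift A ε u = -A ((u / ε) ^ 2) := if_neg (not_le.2 hu)

lemma oddLift_neg (A : ℝ → ℝ) (ε : ℝ) {u : ℝ} (hu : 0 < u) :
    oddLift A ε (-u) = -oddLift A ε u := by
  rw [oddLift_of_neg A ε (by linarith), oddLift_of_nonneg A ε hu.le, neg_div, neg_sq]

/-- For `u < 0 ≤ v` the increment is `A((v/ε)²) + A((u/ε)²)`; comparing both terms with `A 0` costs
at most `2K + 2|A 0|`. For `u ≤ v < 0`, reflection swaps the endpoints. -/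
lemma oddLift_sub_ge {A : ℝ → ℝ} {ε K : ℝ} (hK : 0 ≤ K)
    (hA : ∀ u v, 0 ≤ u → u ≤ v → v ≤ u + 1 →
      -(K * (1 + u ^ 2)) ≤ A ((v / ε) ^ 2) - A ((u / ε) ^ 2))
    {u v : ℝ} (huv : u ≤ v) (hv : v ≤ u + 1) :
    -((4 * K + 2 * |A 0|) * (1 + u ^ 2)) ≤ oddLift A ε v - oddLift A ε u := by
  have hA0 := abs_nonneg (A 0)
  have hA0' : 0 ≤ 2 * |A 0| * (1 + u ^ 2) := by positivity
  have hKu : 0 ≤ K * (1 + u ^ 2) := by positivity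
  rcases le_or_gt 0 u with hu | hu
  · rw [oddLift_of_nonneg A ε hu, oddLift_of_nonneg A ε (hu.trans huv)]
    have := hA u v hu huv hv
    linarith
  · rw [oddLift_of_neg A ε hu]
    rcases le_or_gt 0 v with hv0 | hv0
    · rw [oddLift_of_nonneg A ε hv0]
      have h1 := hA 0 v le_rfl hv0 (by linarith)
      have h2 := hA 0 (-u) le_rfl (by linarith) (by linarith)
      simp only [zero_div, neg_div, neg_sq] at h1 h2
      norm_num at h1 h2
      have h3 := neg_abs_le (A 0)
      have h4 : 0 ≤ K * u ^ 2 := by positivity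
      have h5 : 0 ≤ |A 0| * u ^ 2 := by positivity
      linarith
    · rw [oddLift_of_neg A ε hv0]
      have h1 := hA (-v) (-u) (by linarith) (by linarith) (by linarith)
      simp only [neg_div, neg_sq] at h1
      have h2 : v ^ 2 ≤ u ^ 2 := by nlinarith
      have h3 := mul_le_mul_of_nonneg_left h2 hK
      linarith

lemma integrableOn_comp_sq_div {f : ℝ → ℝ} {ε : ℝ} (hε : 0 < ε) (hf : IntegrableOn f (Ioi 0)) :
    IntegrableOn (fun u => 2 * u * f ((u / ε) ^ 2)) (Ioi 0) := by
  have h1 : IntegrableOn (fun s => f ((ε ^ 2)⁻¹ * s)) (Ioi 0) := by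
    have := (integrableOn_Ioi_comp_mul_left_iff f 0 (a := (ε ^ 2)⁻¹) (by positivity)).2
      (by simpa using hf)
    exact this
  have h2 := (integrableOn_Ioi_comp_rpow_iff (fun s => f ((ε ^ 2)⁻¹ * s)) (p := 2)
    (by norm_num)).2 h1
  refine h2.congr_fun (fun u hu => ?_) measurableSet_Ioi
  simp only [smul_eq_mul]
  norm_num
  left
  congr 1
  field_simp

lemma integral_comp_sq_div (f : ℝ → ℝ) {ε : ℝ} (hε : 0 < ε) :
    ∫ u in Ioi (0 : ℝ), 2 * u * f ((u / ε) ^ 2) = ε ^ 2 * ∫ t in Ioi (0 : ℝ), f t := by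
  have h1 := integral_comp_mul_left_Ioi f 0 (b := (ε ^ 2)⁻¹) (by positivity)
  have h2 := integral_comp_rpow_Ioi_of_pos (g := fun s => f ((ε ^ 2)⁻¹ * s)) (p := 2)
    (by norm_num)
  rw [h1] at h2
  simp only [mul_zero, inv_inv, smul_eq_mul] at h2
  rw [← h2]
  refine setIntegral_congr_fun measurableSet_Ioi fun u hu => ?_
  norm_num
  left
  congr 1
  field_simp

/-- The substitution carries a factor `u`, giving control of order `u⁻⁵` at infinity but none at
`0`; local boundedness of `A` is therefore used on `(0, 1]`. -/
lemma integrableOn_oddLift_div {A : ℝ → ℝ} {ε Λ b : ℝ} (hε : 0 < ε) (hΛ : 0 < Λ)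
    (hA : IntegrableOn (fun t => A t / (t + Λ) ^ 3) (Ioi 0))
    (hb : ∀ t, 0 ≤ t → t ≤ (1 / ε) ^ 2 → |A t| ≤ b) :
    IntegrableOn (fun u => oddLift A ε u / (1 + u) ^ 5) (Ioi 0) := by
  have h1 := integrableOn_comp_sq_div hε hA
  have hmeas : AEStronglyMeasurable (fun u => oddLift A ε u / (1 + u) ^ 5)
      (volume.restrict (Ioi 0)) := by
    have h2 : AEStronglyMeasurable (fun u => 2 * u * (A ((u / ε) ^ 2) / ((u / ε) ^ 2 + Λ) ^ 3) *
        (((u / ε) ^ 2 + Λ) ^ 3 / (2 * u * (1 + u) ^ 5))) (volume.restrict (Ioi 0)) :=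
      h1.aestronglyMeasurable.mul (Measurable.aestronglyMeasurable (by fun_prop))
    refine h2.congr ((ae_restrict_iff' measurableSet_Ioi).2 (Eventually.of_forall fun u hu => ?_))
    have hu : 0 < u := hu
    have h3 : 0 < (u / ε) ^ 2 + Λ := by positivity
    simp only [oddLift_of_nonneg A ε hu.le]
    field_simp
  rw [← Ioc_union_Ioi_eq_Ioi zero_le_one, integrableOn_union]
  constructor
  · refine Integrable.mono' (g := fun _ => b) (integrableOn_const (by simp) enorm_ne_top)
      (hmeas.mono_measure (Measure.restrict_mono Ioc_subset_Ioi_self le_rfl)) ?_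
    refine (ae_restrict_iff' measurableSet_Ioc).2 (Eventually.of_forall fun u hu => ?_)
    rw [oddLift_of_nonneg A ε hu.1.le, norm_div, Real.norm_eq_abs]
    have h2 : (u / ε) ^ 2 ≤ (1 / ε) ^ 2 := by
      have := hu.1
      have := hu.2
      gcongr
    have h3 : (1 : ℝ) ≤ ‖(1 + u) ^ 5‖ := by
      rw [Real.norm_of_nonneg (by have := hu.1; positivity)]
      exact one_le_pow₀ (by linarith [hu.1])
    exact (div_le_self (abs_nonneg _) h3).trans (hb _ (sq_nonneg _) h2)
  · set c := (ε ^ 2)⁻¹ + Λ with hc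
    have hc0 : 0 < c := by positivity
    have hsub : Ioi (1 : ℝ) ⊆ Ioi 0 := Ioi_subset_Ioi zero_le_one
    refine Integrable.mono' ((h1.mono_set hsub).norm.const_mul (c ^ 3))
      (hmeas.mono_measure (Measure.restrict_mono hsub le_rfl)) ?_
    refine (ae_restrict_iff' measurableSet_Ioi).2 (Eventually.of_forall fun u hu => ?_)
    have hu1 : 1 < u := hu
    have hu0 : 0 < u := by linarith
    have hq : 0 < (u / ε) ^ 2 + Λ := by positivity
    rw [oddLift_of_nonneg A ε hu0.le, norm_div, norm_mul, norm_div,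
      Real.norm_of_nonneg (by positivity : 0 ≤ (1 + u) ^ 5),
      Real.norm_of_nonneg (by positivity : 0 ≤ 2 * u),
      Real.norm_of_nonneg (by positivity : 0 ≤ ((u / ε) ^ 2 + Λ) ^ 3)]
    have h2 : (u / ε) ^ 2 + Λ ≤ c * (1 + u) ^ 2 := by
      have h3 : u ^ 2 ≤ (1 + u) ^ 2 := by nlinarith
      have h4 : 1 ≤ (1 + u) ^ 2 := by nlinarith
      rw [div_pow, div_eq_inv_mul, hc, add_mul]
      have h5 := mul_le_mul_of_nonneg_left h3 (by positivity : 0 ≤ (ε ^ 2)⁻¹)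
      have h6 := mul_le_mul_of_nonneg_left h4 hΛ.le
      linarith
    have h7 : ((u / ε) ^ 2 + Λ) ^ 3 ≤ c ^ 3 * (2 * u) * (1 + u) ^ 5 := by
      calc _ ≤ (c * (1 + u) ^ 2) ^ 3 := pow_le_pow_left₀ hq.le h2 3
        _ = c ^ 3 * (1 + u) * (1 + u) ^ 5 := by ring
        _ ≤ _ := by gcongr; linarith
    rw [show c ^ 3 * (2 * u * (‖A ((u / ε) ^ 2)‖ / ((u / ε) ^ 2 + Λ) ^ 3)) =
      ‖A ((u / ε) ^ 2)‖ * (c ^ 3 * (2 * u)) / ((u / ε) ^ 2 + Λ) ^ 3 by ring,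
      div_le_div_iff₀ (by positivity) (by positivity)]
    calc _ ≤ ‖A ((u / ε) ^ 2)‖ * (c ^ 3 * (2 * u) * (1 + u) ^ 5) :=
          mul_le_mul_of_nonneg_left h7 (norm_nonneg _)
      _ = _ := by ring

lemma integral_oddLift_eq (A : ℝ → ℝ) {ε : ℝ} (hε : 0 < ε) (z : ℝ) :
    ∫ u in Ioi (0 : ℝ), oddLift A ε u * (u / (u ^ 2 + z ^ 2) ^ 3) =
      (2 * ε ^ 4)⁻¹ * ∫ t in Ioi (0 : ℝ), A t / (t + (z / ε) ^ 2) ^ 3 := by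
  have h := integral_comp_sq_div (fun t => A t / (t + (z / ε) ^ 2) ^ 3) hε
  have h2 : ∫ t in Ioi (0 : ℝ), A t / (t + (z / ε) ^ 2) ^ 3 = (ε ^ 2)⁻¹ *
      ∫ u in Ioi (0 : ℝ), 2 * u * (A ((u / ε) ^ 2) / ((u / ε) ^ 2 + (z / ε) ^ 2) ^ 3) := by
    rw [h, ← mul_assoc, inv_mul_cancel₀ (by positivity), one_mul]
  rw [h2, ← mul_assoc, ← integral_const_mul]
  refine setIntegral_congr_fun measurableSet_Ioi fun u hu => ?_
  have hu : 0 < u := hu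
  have h3 : (u / ε) ^ 2 + (z / ε) ^ 2 = (u ^ 2 + z ^ 2) / ε ^ 2 := by ring
  have h4 : 0 < u ^ 2 + z ^ 2 := by positivity
  simp only [oddLift_of_nonneg A ε hu.le, h3]
  field_simp

end StieltjesTauber

/-! ### Assembly of the constants. -/

theorem theorem3p1 :
    ∃ C : ℝ, 0 < C ∧
      ∀ (δ t₀ C₀ Λ ε₀ : ℝ) (B₀ B₁ B₂ : ℝ → ℝ) (CB₀ CB₂ : ℝ),
        0 < δ → 0 < t₀ → 0 < C₀ → 0 < Λ → 0 < ε₀ →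
        (∃ M : ℝ, ∀ t : ℝ, 0 ≤ t → |B₀ t| ≤ M) →
        MonotoneOn B₁ (Ici 0) →
        StieltjesTauber.RightContinuous B₁ →
        IsLUB (StieltjesTauber.growthRatios t₀ B₂) CB₂ →
        IsGLB (StieltjesTauber.monotonicityDefects δ B₀) (-CB₀) →
        StieltjesTauber.RightContinuous (fun u => u ^ 3 * B₀ (u ^ 2)) →
        LocallyBoundedVariationOn (fun u => u ^ 3 * B₀ (u ^ 2)) (Ici 0) →
        StieltjesTauber.RightContinuous (fun u => B₂ (u ^ 2)) →
        LocallyBoundedVariationOn (fun u => B₂ (u ^ 2)) (Ici 0) →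
        (∀ l : ℝ, Λ ≤ l →
          IntegrableOn (fun t => StieltjesTauber.total B₀ B₁ B₂ t / (t + l) ^ 3) (Ioi 0) ∧
          |∫ t in Ioi (0 : ℝ), StieltjesTauber.total B₀ B₁ B₂ t / (t + l) ^ 3|
            ≤ C₀ * (Real.exp (-(ε₀ * Real.sqrt l)) / l)) →
        (StieltjesTauber.total B₀ B₁ B₂ =O[atTop] fun t : ℝ => t) ∧
        ∃ 𝓑 : ℝ,
          (∀ t : ℝ, 0 ≤ t →
            |StieltjesTauber.total B₀ B₁ B₂ t| ≤ 𝓑 * ε₀⁻¹ * (t + (ε₀ ^ 2)⁻¹)) ∧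
          𝓑 ≤
            C * ε₀ ^ 3 * (1 + ε₀ * Real.sqrt Λ * Real.exp (ε₀ * Real.sqrt Λ / 2)) *
                (StieltjesTauber.linftyNorm B₀ * Λ ^ (3 / 2 : ℝ) + |B₁ 0|
                  + CB₂ * t₀ * (1 + δ⁻¹ * ε₀⁻¹) + CB₂ * Λ)
            + C * ε₀ ^ 3 * Λ *
                (ε₀ * Real.sqrt Λ * Real.exp (ε₀ * Real.sqrt Λ / 2) + (ε₀ ^ 2)⁻¹ * Λ⁻¹) * C₀
            + C * (ε₀ + δ⁻¹) *
                (CB₀ + StieltjesTauber.linftyNorm B₀ * (δ + ε₀⁻¹)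
                  + CB₂ * (1 + Real.log (1 + δ * ε₀))) := by
  obtain ⟨C, hC, hmain⟩ := StieltjesTauber.exists_abs_le_of_stieltjes_le
  -- `24` is the coefficient of `M` in `ε³K` (see `e1`) and dominates the other coefficients.
  refine ⟨24 * C, by positivity, ?_⟩
  intro δ t₀ C₀ Λ ε B₀ B₁ B₂ D E hδ ht₀ hC₀ hΛ hε hbdd hmono _ hE hD hrc _ _ _ hF
  obtain ⟨M₀, hM₀⟩ := hbdd
  set A := StieltjesTauber.total B₀ B₁ B₂ with hA
  set M := StieltjesTauber.linftyNorm B₀ with hM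
  have hM0 : 0 ≤ M := ENNReal.toReal_nonneg
  have hMB : ∀ t, 0 < t → |B₀ t| ≤ M := fun t ht =>
    StieltjesTauber.abs_le_linftyNorm hM₀ hrc ht
  have hE0 : 0 ≤ E := (by positivity : 0 ≤ |B₂ 0| / (t₀ + 0)).trans (hE.1 ⟨0, le_rfl, rfl⟩)
  have hB₂ : ∀ t, 0 ≤ t → |B₂ t| ≤ E * (t₀ + t) := fun t ht =>
    (div_le_iff₀ (by positivity)).1 (hE.1 ⟨t, ht, rfl⟩)
  have hD0 : 0 ≤ D := by
    have := hD.1 ⟨0, 0, le_rfl, le_rfl, by linarith, rfl⟩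
    simpa using this
  have hDB : ∀ u v, 0 ≤ u → u ≤ v → v ≤ u + δ → -D ≤ u * (B₀ (v ^ 2) - B₀ (u ^ 2)) :=
    fun u v hu huv hv => (hD.1 ⟨u, v, hu, huv, hv, rfl⟩).trans (min_le_left _ _)
  have hA0 : |A 0| ≤ |B₁ 0| + E * t₀ := by
    have h1 : A 0 = B₁ 0 + B₂ 0 := by
      rw [hA, StieltjesTauber.total, Real.zero_rpow (by norm_num)]; ring
    have h2 := hB₂ 0 le_rfl
    rw [add_zero] at h2
    rw [h1]
    exact (abs_add_le _ _).trans (by linarith)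
  -- `total_sq_sub_ge` with `L = 1/ε`, a unit step in the lifted variable, after `v² ≤ 2(1+u²)`.
  set K₀ := 6 * M / ε ^ 3 + (1 / ε / δ + 1) * (2 * D / ε ^ 2) + E * (2 * t₀ + 3 / ε ^ 2) with hK₀
  have hK₀0 : 0 ≤ K₀ := by positivity
  have hinc : ∀ u v, 0 ≤ u → u ≤ v → v ≤ u + 1 →
      -(K₀ * (1 + u ^ 2)) ≤ A ((v / ε) ^ 2) - A ((u / ε) ^ 2) := by
    intro u v hu huv hv
    have h1 := StieltjesTauber.total_sq_sub_ge (L := 1 / ε) hM0 hMB hD0 hδ hDB hmono hB₂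
      (by positivity) (div_nonneg hu hε.le) (div_le_div_of_nonneg_right huv hε.le)
      (by rw [← add_div]; exact div_le_div_of_nonneg_right hv hε.le)
    refine le_trans (neg_le_neg ?_) h1
    have hv2 : v ^ 2 ≤ 2 * (1 + u ^ 2) := by nlinarith [sq_nonneg (u - 1)]
    have hV : (v / ε) ^ 2 ≤ 2 * (1 + u ^ 2) / ε ^ 2 := by
      rw [div_pow]; exact div_le_div_of_nonneg_right hv2 (by positivity)
    have hU : (u / ε) ^ 2 ≤ (1 + u ^ 2) / ε ^ 2 := by
      rw [div_pow]; exact div_le_div_of_nonneg_right (by linarith) (by positivity)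
    have h2 : 2 * t₀ ≤ 2 * t₀ * (1 + u ^ 2) := by nlinarith [sq_nonneg u]
    calc _ ≤ 3 * M * (1 / ε) * (2 * (1 + u ^ 2) / ε ^ 2) +
          (1 / ε / δ + 1) * (2 * (1 + u ^ 2) / ε ^ 2 * D) +
          E * (2 * t₀ * (1 + u ^ 2) + (1 + u ^ 2) / ε ^ 2 + 2 * (1 + u ^ 2) / ε ^ 2) := by
          gcongr
      _ = _ := by rw [hK₀]; field_simp; ring
  have hNi : IntegrableOn (fun u => StieltjesTauber.oddLift A ε u / (1 + u) ^ 5) (Ioi 0) := by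
    set T := (1 / ε) ^ 2 with hT
    refine StieltjesTauber.integrableOn_oddLift_div
      (b := M₀ * T ^ (3 / 2 : ℝ) + (|B₁ 0| + |B₁ T|) + E * (t₀ + T)) hε hΛ (hF Λ le_rfl).1
      fun t ht htT => ?_
    have hT0 : 0 ≤ T := ht.trans htT
    have h1 : |B₀ t * t ^ (3 / 2 : ℝ)| ≤ M₀ * T ^ (3 / 2 : ℝ) := by
      rw [abs_mul, abs_of_nonneg (Real.rpow_nonneg ht _)]
      exact mul_le_mul (hM₀ t ht) (Real.rpow_le_rpow ht htT (by norm_num))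
        (Real.rpow_nonneg ht _) ((abs_nonneg _).trans (hM₀ t ht))
    have h2 : |B₁ t| ≤ |B₁ 0| + |B₁ T| := by
      have h3 := hmono (mem_Ici.2 le_rfl) (mem_Ici.2 ht) ht
      have h4 := hmono (mem_Ici.2 ht) (mem_Ici.2 hT0) htT
      rw [abs_le]
      constructor
      · linarith [neg_abs_le (B₁ 0), abs_nonneg (B₁ T)]
      · linarith [le_abs_self (B₁ T), abs_nonneg (B₁ 0)]
    have h5 : |B₂ t| ≤ E * (t₀ + T) :=
      (hB₂ t ht).trans (mul_le_mul_of_nonneg_left (by linarith) hE0)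
    exact (abs_add_three _ _ _).trans (by linarith)
  have hNF : ∀ z, ε * Real.sqrt Λ ≤ z →
      |∫ u in Ioi (0 : ℝ), StieltjesTauber.oddLift A ε u * (u / (u ^ 2 + z ^ 2) ^ 3)| ≤
        (2 * ε ^ 4)⁻¹ * (C₀ / Λ) * Real.exp (-z) := by
    intro z hz
    have hz0 : 0 ≤ z := (by positivity : 0 ≤ ε * Real.sqrt Λ).trans hz
    have h1 : Real.sqrt Λ ≤ z / ε := by rw [le_div_iff₀ hε]; linarith
    have hl : Λ ≤ (z / ε) ^ 2 := by
      rw [← Real.sq_sqrt hΛ.le]; exact pow_le_pow_left₀ (Real.sqrt_nonneg _) h1 2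
    have h2 := (hF _ hl).2
    rw [Real.sqrt_sq (by positivity), mul_div_cancel₀ _ hε.ne'] at h2
    rw [StieltjesTauber.integral_oddLift_eq A hε, abs_mul,
      abs_of_pos (by positivity : 0 < (2 * ε ^ 4)⁻¹), mul_assoc]
    refine mul_le_mul_of_nonneg_left (h2.trans ?_) (by positivity)
    rw [div_mul_eq_mul_div, mul_div_assoc]
    gcongr
  set K := 4 * K₀ + 2 * |A 0| with hK
  have hK0 : 0 ≤ K := by positivity
  have hN := hmain (StieltjesTauber.oddLift A ε) K _ _ hK0
    (fun u hu => StieltjesTauber.oddLift_neg A ε hu) hNi hNF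
    (fun u v huv hv => StieltjesTauber.oddLift_sub_ge hK₀0 hinc huv hv)
  have hbound : ∀ t : ℝ, 0 ≤ t → |A t| ≤ C * K * ε ^ 3 * ε⁻¹ * (t + (ε ^ 2)⁻¹) := by
    intro t ht
    have h1 := hN (ε * Real.sqrt t)
    rw [StieltjesTauber.oddLift_of_nonneg A ε (by positivity), mul_div_cancel_left₀ _ hε.ne',
      mul_pow, Real.sq_sqrt ht] at h1
    refine h1.trans (le_of_eq ?_)
    field_simp
    ring
  refine ⟨?_, C * K * ε ^ 3, hbound, ?_⟩
  · refine IsBigO.of_bound (C * K * ε ^ 3 * ε⁻¹ * (1 + (ε ^ 2)⁻¹)) ?_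
    filter_upwards [eventually_ge_atTop 1] with t ht
    rw [Real.norm_eq_abs, Real.norm_of_nonneg (by linarith : 0 ≤ t), mul_assoc]
    refine (hbound t (by linarith)).trans (mul_le_mul_of_nonneg_left ?_ (by positivity))
    have : 0 ≤ (ε ^ 2)⁻¹ := by positivity
    nlinarith
  · set X := ε * Real.sqrt Λ * Real.exp (ε * Real.sqrt Λ / 2) with hX
    have hX0 : 0 ≤ X := by positivity
    have hlog : 0 ≤ Real.log (1 + δ * ε) := Real.log_nonneg (by nlinarith [mul_pos hδ hε])
    have e1 : ε ^ 3 * K = 24 * M + 8 * (ε + δ⁻¹) * D + 12 * (ε * E) + 8 * (ε ^ 3 * (E * t₀)) +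
        2 * (ε ^ 3 * |A 0|) := by
      rw [hK, hK₀]; field_simp; ring
    have e2 : ε ^ 3 * |A 0| ≤ ε ^ 3 * |B₁ 0| + ε ^ 3 * (E * t₀) := by
      rw [← mul_add]; exact mul_le_mul_of_nonneg_left hA0 (by positivity)
    have r1 : ε ^ 3 * |B₁ 0| + ε ^ 3 * (E * t₀) ≤ ε ^ 3 * (1 + X) *
        (M * Λ ^ (3 / 2 : ℝ) + |B₁ 0| + E * t₀ * (1 + δ⁻¹ * ε⁻¹) + E * Λ) := by
      rw [← mul_add, mul_assoc]
      refine mul_le_mul_of_nonneg_left ?_ (by positivity)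
      have h1 : |B₁ 0| + E * t₀ ≤
          M * Λ ^ (3 / 2 : ℝ) + |B₁ 0| + E * t₀ * (1 + δ⁻¹ * ε⁻¹) + E * Λ := by
        have h2 : 0 ≤ M * Λ ^ (3 / 2 : ℝ) := by positivity
        have h3 : 0 ≤ E * t₀ * (δ⁻¹ * ε⁻¹) := by positivity
        have h4 : 0 ≤ E * Λ := by positivity
        linarith
      refine h1.trans (le_mul_of_one_le_left ?_ (by linarith))
      exact (by positivity : 0 ≤ |B₁ 0| + E * t₀).trans h1
    -- The term with `C₀` is needed only as a nonnegative surplus.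
    have r2 : 0 ≤ ε ^ 3 * Λ * (X + (ε ^ 2)⁻¹ * Λ⁻¹) * C₀ := by positivity
    -- The summand `M` is the product `δ⁻¹ · Mδ`, and `ε E` is `ε` times the `1` in `1 + log(1+δε)`;
    -- the remaining products are nonnegative.
    have r3 : (ε + δ⁻¹) * D + M + ε * E ≤ (ε + δ⁻¹) *
        (D + M * (δ + ε⁻¹) + E * (1 + Real.log (1 + δ * ε))) := by
      have h1 : (ε + δ⁻¹) * (D + M * (δ + ε⁻¹) + E * (1 + Real.log (1 + δ * ε))) =
          (ε + δ⁻¹) * D + M + ε * E + (M * (ε * δ + 1 + δ⁻¹ * ε⁻¹) +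
            (δ⁻¹ * E + (ε + δ⁻¹) * E * Real.log (1 + δ * ε))) := by
        field_simp
        ring
      rw [h1]
      exact le_add_of_nonneg_right (by positivity)
    have p1 : 0 ≤ (ε + δ⁻¹) * D := by positivity
    have p2 : 0 ≤ ε * E := by positivity
    have p3 : 0 ≤ ε ^ 3 * |B₁ 0| := by positivity
    have p4 : 0 ≤ ε ^ 3 * (E * t₀) := by positivity
    have hfin : ε ^ 3 * K ≤ 24 * (ε ^ 3 * (1 + X) *
        (M * Λ ^ (3 / 2 : ℝ) + |B₁ 0| + E * t₀ * (1 + δ⁻¹ * ε⁻¹) + E * Λ) +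
        ε ^ 3 * Λ * (X + (ε ^ 2)⁻¹ * Λ⁻¹) * C₀ + (ε + δ⁻¹) *
        (D + M * (δ + ε⁻¹) + E * (1 + Real.log (1 + δ * ε)))) := by
      rw [e1]
      linarith
    have hfin2 := mul_le_mul_of_nonneg_left hfin hC.le
    linarith
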